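/- **Setting.** Let $\mu$ be a (positive Borel) measure on $\mathbb R$ with finite moments, $\int |x|^k\,d\mu<\infty$ for all $k\ge 0$, whose support has at least $n\ge 1$ points. The orthogonal polynomial ensemble (OPE) of size $n$ associated with $\mu$ is the probability measure on $\mathbb R^n$ $$\frac1{Z_n}\prod_{i>j}(x_i-x_j)^2\,d\mu(x_1)\cdots d\mu(x_n),$$ $Z_n$ being the normalizing constant. $P$ and $\mathbb E$ refer to this law, and for $f:\mathbb R\to\mathbb R$ we put $X_f^{(n)}=\sum_{j=1}^n f(x_j)$. Let $p_j(x)=\gamma_jx^j+\cdots$, $\gamma_j>0$, be the orthonormal polynomials of $\mu$ (they exist for every $j$ smaller than the number of points of $\operatorname{supp}\mu$) and $K_n(x,y)=\sum_{j=0}^{n-1}p_j(x)p_j(y)$. For a sequence $(\mu_n)_{n\ge1}$ of such measures, $P$, $\mathbb E$, $X_f^{(n)}$ and $K_n$ at index $n$ refer to the OPE of size $n$ of $\mu_n$ and to its kernel, and $\gamma^{(n)}_j$ are the leading coefficients for $\mu_n$. Throughout, $\|f\|_\infty\in[0,\infty]$ is the norm of $L^\infty(\mu)$ (of $L^\infty(\mu_n)$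 for a sequence); it is at most $\sup_{\mathbb R}|f|$. In the bounds, $a/0=\infty$ for $a>0$, $a/\infty=0$ and $e^{-\infty}=0$. **Theorem.** **I.** There is a universal constant $A>0$ such that for every $n\ge1$, every measure $\mu$ with finite moments whose support has at least $n$ points, every bounded Borel function $f$ and every $\varepsilon>0$, $$P\left(\left|\tfrac1nX_f^{(n)}-\tfrac1n\mathbb E X_f^{(n)}\right|\ge\varepsilon\right)\le 2\exp\left(-n\varepsilon\min\left(\frac{\varepsilon}{8A\|f\|_\infty^2},\frac1{6\|f\|_\infty}\right)\right).$$ Moreover, let $(\mu_n)_{n\ge1}$ be measures with finite moments such that $\operatorname{supp}\mu_n$ has at least $n$ points, and suppose that $\frac1nK_n(x,x)\,d\mu_n(x)$ converges weakly (tested against all bounded continuous functions) to a finite measure $\nu$. If, for all $n\ge1$, random vectors with the laws of the OPEs of size $n$ of $\mu_n$ are defined on a common probability space (with an arbitrary joint law), then for every bounded continuous $f$, almost surely, $$\lim_{n\to\infty}\tfrac1nX_f^{(n)}=\int f\,d\nu .$$ **II.** Assume that either (a) $\mu_n=\mu$ for all $n$, where $\mu$ has finite moments and infinite compact support, and $f$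 is continuous; or (b) the $\mu_n$ have finite moments, $\operatorname{supp}\mu_n$ has more than $n$ points for all $n\ge1$, $\frac1n\bigl(\gamma^{(n)}_{n-1}/\gamma^{(n)}_n\bigr)^2\to0$, and $f$ is bounded and uniformly continuous. Then for every $\varepsilon>0$ and all sufficiently large $n$, $$P\left(\left|\tfrac1nX_f^{(n)}-\tfrac1n\mathbb E X_f^{(n)}\right|\ge\varepsilon\right)\le 2\exp\left(-\frac{n\varepsilon}{6\|f\|_\infty}\right).$$ **III.** Assume that either (a) $\mu_n=\mu$ for all $n$, where $\mu$ has finite moments and infinite compact support; or (b) the $\mu_n$ have finite moments, $\operatorname{supp}\mu_n$ has more than $n$ points for all $n\ge1$, and $\bigl(\gamma^{(n)}_{n-1}/\gamma^{(n)}_n\bigr)^2=O(1)$ as $n\to\infty$. Then there is a constant $A>0$ such that for every Lipschitz function $f$ with Lipschitz constant $|f|_{\mathcal L}$, every $\varepsilon>0$ and all sufficiently large $n$, $$P\left(\left|X_f^{(n)}-\mathbb E X_f^{(n)}\right|\ge\varepsilon\right)\le 2\exp\left(-\varepsilon\min\left(\frac{\varepsilon}{4A|f|_{\mathcal L}^2},\frac1{6\|f\|_\infty}\right)\right).$$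 -/

import Mathlib

open MeasureTheory ProbabilityTheory Filter Topology Polynomial
open scoped ENNReal NNReal BoundedContinuousFunction

namespace OPE

noncomputable section

/-! ### The ensemble -/

/-- All moments of `μ` exist and are finite (the zeroth one too, so `μ` is a finite measure). -/
def HasFiniteMoments (μ : Measure ℝ) : Prop :=
  ∀ k : ℕ, Integrable (fun x : ℝ => x ^ k) μ

/-- The squared Vandermonde determinant `∏_{i > j} (x_i - x_j)²`. -/
def vandermondeSq {n : ℕ} (x : Fin n → ℝ) : ℝ :=
  ∏ i : Fin n, ∏ j ∈ Finset.Iio i, (x i - x j) ^ 2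

/-- The measure `∏_{i > j} (x_i - x_j)² dμ(x_1) ⋯ dμ(x_n)` on `ℝⁿ`. -/
def unnormalizedEnsemble (μ : Measure ℝ) (n : ℕ) : Measure (Fin n → ℝ) :=
  (Measure.pi fun _ : Fin n => μ).withDensity fun x => ENNReal.ofReal (vandermondeSq x)

/-- The orthogonal polynomial ensemble of size `n` associated with `μ`: the probability measure
`Z_n⁻¹ ∏_{i > j} (x_i - x_j)² dμ(x_1) ⋯ dμ(x_n)`, where `Z_n` is the total mass of
`∏_{i > j} (x_i - x_j)² dμ(x_1) ⋯ dμ(x_n)`. -/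
def ensemble (μ : Measure ℝ) (n : ℕ) : Measure (Fin n → ℝ) :=
  (unnormalizedEnsemble μ n Set.univ)⁻¹ • unnormalizedEnsemble μ n

/-- The linear statistic `X_f = ∑ f(x_j)`. -/
def linStat (f : ℝ → ℝ) {n : ℕ} (x : Fin n → ℝ) : ℝ := ∑ j, f (x j)

/-- The expectation of `X_f` in the ensemble of size `n`. -/
def meanLinStat (μ : Measure ℝ) (n : ℕ) (f : ℝ → ℝ) : ℝ := ∫ x, linStat f x ∂(ensemble μ n)

/-! ### Orthogonal polynomials -/

/-- The monic orthogonal polynomials of `μ`, by the Gram-Schmidt process. -/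
def monicPoly (μ : Measure ℝ) (n : ℕ) : ℝ[X] :=
  X ^ n - ∑ i : Fin n,
    C ((∫ x, x ^ n * (monicPoly μ i).eval x ∂μ) / ∫ x, (monicPoly μ i).eval x ^ 2 ∂μ) *
      monicPoly μ i
  termination_by n
  decreasing_by all_goals exact i.2

/-- The orthonormal polynomials `p_n` of `μ`. -/
def orthoPoly (μ : Measure ℝ) (n : ℕ) : ℝ[X] :=
  C (Real.sqrt (∫ x, (monicPoly μ n).eval x ^ 2 ∂μ))⁻¹ * monicPoly μ n

/-- The leading coefficient `γ_n` of `p_n`. -/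
def leadCoeff (μ : Measure ℝ) (n : ℕ) : ℝ := (orthoPoly μ n).leadingCoeff

/-- The Christoffel-Darboux kernel `K_n(x, y) = ∑_{j < n} p_j(x) p_j(y)`. -/
def cdKernel (μ : Measure ℝ) (n : ℕ) (x y : ℝ) : ℝ :=
  ∑ j ∈ Finset.range n, (orthoPoly μ j).eval x * (orthoPoly μ j).eval y

/-- The measure `n⁻¹ K_n(x, x) dμ(x)`. -/
def meanDensity (μ : Measure ℝ) (n : ℕ) : Measure ℝ :=
  μ.withDensity fun x => ENNReal.ofReal (cdKernel μ n x x / n)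

/-- Weak convergence of a sequence of measures: convergence of the integrals of all bounded
continuous functions. -/
def TendstoWeakly (m : ℕ → Measure ℝ) (ν : Measure ℝ) : Prop :=
  ∀ g : ℝ →ᵇ ℝ, Tendsto (fun n => ∫ x, g x ∂(m n)) atTop (𝓝 (∫ x, g x ∂ν))

/-! ### Bounds -/

/-- `‖f‖_∞`, the norm of `L^∞(μ)`, with value `∞` if `f` is not essentially bounded. -/
def supNorm (μ : Measure ℝ) (f : ℝ → ℝ) : ℝ≥0∞ := eLpNorm f ∞ μ

/-- `e^{-r}` for `r ∈ [0, ∞]`, with `e^{-∞} = 0`. -/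
def expNeg (r : ℝ≥0∞) : ℝ≥0∞ := EReal.exp (-(r : EReal))

/-! ### The polynomials `p_n` are the orthonormal polynomials of `μ` -/

lemma monicPoly_eq (μ : Measure ℝ) (n : ℕ) : monicPoly μ n = X ^ n - ∑ i : Fin n,
    C ((∫ x, x ^ n * (monicPoly μ i).eval x ∂μ) / ∫ x, (monicPoly μ i).eval x ^ 2 ∂μ) *
      monicPoly μ i := by
  conv_lhs => rw [monicPoly]

lemma monicPoly_monic_degree (μ : Measure ℝ) (n : ℕ) :
    (monicPoly μ n).Monic ∧ (monicPoly μ n).degree = n := by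
  induction n using Nat.strong_induction_on with
  | _ n ih =>
    have h : (∑ i : Fin n, C ((∫ x, x ^ n * (monicPoly μ i).eval x ∂μ) /
        ∫ x, (monicPoly μ i).eval x ^ 2 ∂μ) * monicPoly μ i).degree < (n : WithBot ℕ) := by
      refine lt_of_le_of_lt (degree_sum_le _ _) ?_
      refine (Finset.sup_lt_iff (WithBot.bot_lt_coe n)).2 ?_
      intro i _
      refine lt_of_le_of_lt (by rw [← smul_eq_C_mul]; exact degree_smul_le _ _) (?_ : degree (monicPoly μ i) < n)
      rw [(ih i i.2).2]
      exact_mod_cast i.2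
    rw [monicPoly_eq]
    refine ⟨monic_X_pow_sub h, ?_⟩
    rw [degree_sub_eq_left_of_degree_lt, degree_X_pow]
    rwa [degree_X_pow]

lemma HasFiniteMoments.integrable_eval {μ : Measure ℝ} (h : HasFiniteMoments μ) (p : ℝ[X]) :
    Integrable (fun x => p.eval x) μ := by
  simp only [eval_eq_sum_range]
  exact integrable_finsetSum _ fun i _ => (h i).const_mul _

lemma integral_monicPoly_sq_pos {μ : Measure ℝ} (h : HasFiniteMoments μ) {n : ℕ}
    (hn : (n : ℕ∞) < μ.support.encard) : 0 < ∫ x, (monicPoly μ n).eval x ^ 2 ∂μ := by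
  have hint : Integrable (fun x => (monicPoly μ n).eval x ^ 2) μ := by
    have h2 := h.integrable_eval (monicPoly μ n ^ 2)
    simp only [eval_pow] at h2
    exact h2
  refine lt_of_le_of_ne (integral_nonneg fun x => sq_nonneg _) fun h0 => ?_
  have h1 := (integral_eq_zero_iff_of_nonneg (fun x => sq_nonneg _) hint).1 h0.symm
  have hne : monicPoly μ n ≠ 0 := (monicPoly_monic_degree μ n).1.ne_zero
  have hsub : μ.support ⊆ ((monicPoly μ n).roots.toFinset : Set ℝ) := by
    refine Measure.support_subset_of_isClosed (Finset.finite_toSet _).isClosed ?_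
    filter_upwards [h1] with x hx
    simpa [hne] using hx
  have hcard := Set.encard_le_encard hsub
  rw [Set.encard_coe_eq_coe_finsetCard] at hcard
  have hle : (monicPoly μ n).roots.toFinset.card ≤ n :=
    (Multiset.toFinset_card_le _).trans ((card_roots' _).trans
      (natDegree_eq_of_degree_eq_some (monicPoly_monic_degree μ n).2).le)
  exact absurd (hn.trans_le hcard) (not_lt.2 (by exact_mod_cast hle))

lemma integral_monicPoly_mul {μ : Measure ℝ} (h : HasFiniteMoments μ) (n : ℕ)
    (hn : (n : ℕ∞) ≤ μ.support.encard) (m : ℕ) (hm : m < n) :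
    ∫ x, (monicPoly μ n).eval x * (monicPoly μ m).eval x ∂μ = 0 := by
  induction n using Nat.strong_induction_on generalizing m with
  | _ n ih =>
    have hlt : ∀ i : ℕ, i < n → (i : ℕ∞) < μ.support.encard := fun i hi =>
      lt_of_lt_of_le (by exact_mod_cast hi) hn
    have hz : ∀ i j : ℕ, i < n → j < n → i ≠ j →
        ∫ x, (monicPoly μ i).eval x * (monicPoly μ j).eval x ∂μ = 0 := by
      intro i j hi hj hij
      rcases lt_or_gt_of_ne hij with hc | hc
      · simpa only [mul_comm] using ih j hj (hlt j hj).le i hc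
      · exact ih i hi (hlt i hi).le j hc
    have hI : ∀ p q : ℝ[X], Integrable (fun x => p.eval x * q.eval x) μ := fun p q => by
      simpa using h.integrable_eval (p * q)
    rw [monicPoly_eq]
    simp only [eval_sub, eval_pow, eval_X, eval_finsetSum, eval_mul, eval_C, sub_mul,
      Finset.sum_mul, mul_assoc]
    rw [integral_sub, integral_finsetSum]
    · simp only [integral_const_mul]
      rw [Finset.sum_eq_single (⟨m, hm⟩ : Fin n)]
      · have hp := integral_monicPoly_sq_pos h (hlt m hm)
        simp only [← sq]
        field_simp
        simp
      · intro i _ hi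
        rw [hz i m i.2 hm fun hc => hi (Fin.ext hc), mul_zero]
      · simp
    · exact fun i _ => (hI _ _).const_mul _
    · simpa using hI (X ^ n) (monicPoly μ m)
    · exact integrable_finsetSum _ fun i _ => (hI _ _).const_mul _

/-- If the support of `μ` has more than `n` points, then `p_n` has degree `n` and a positive
leading coefficient, and `p_0, …, p_n` are orthonormal in `L²(μ)`. -/
theorem orthoPoly_spec {μ : Measure ℝ} (h : HasFiniteMoments μ) {n : ℕ}
    (hn : (n : ℕ∞) < μ.support.encard) :
    (orthoPoly μ n).natDegree = n ∧ 0 < leadCoeff μ n ∧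
      ∀ m ≤ n, ∫ x, (orthoPoly μ n).eval x * (orthoPoly μ m).eval x ∂μ =
        if m = n then 1 else 0 := by
  have hp := integral_monicPoly_sq_pos h hn
  have hs : 0 < (Real.sqrt (∫ x, (monicPoly μ n).eval x ^ 2 ∂μ))⁻¹ := by positivity
  have hd := monicPoly_monic_degree μ n
  refine ⟨?_, ?_, fun m hm => ?_⟩
  · rw [orthoPoly, natDegree_C_mul hs.ne', natDegree_eq_of_degree_eq_some hd.2]
  · rw [leadCoeff, orthoPoly, leadingCoeff_mul, leadingCoeff_C, hd.1.leadingCoeff, mul_one]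
    exact hs
  · have e : ∀ x : ℝ, (orthoPoly μ n).eval x * (orthoPoly μ m).eval x =
        ((Real.sqrt (∫ x, (monicPoly μ n).eval x ^ 2 ∂μ))⁻¹ *
          (Real.sqrt (∫ x, (monicPoly μ m).eval x ^ 2 ∂μ))⁻¹) *
          ((monicPoly μ n).eval x * (monicPoly μ m).eval x) := fun x => by
      simp only [orthoPoly, eval_mul, eval_C]
      ring
    simp only [e, integral_const_mul]
    split_ifs with hmn
    · subst hmn
      simp only [← sq]
      rw [inv_pow, Real.sq_sqrt hp.le, inv_mul_cancel₀ hp.ne']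
    · rw [integral_monicPoly_mul h n hn.le m (lt_of_le_of_ne hm hmn), mul_zero]

end

end OPE

/-! The density of the ensemble is `det (p_i(x_j))² / n!`, so exponential moments of linear
statistics are determinants, and everything follows from one Gaussian bound: if `|f| ≤ S` almost
everywhere and `3 S |t| ≤ 1`, then `E exp(t X_f) ≤ exp(t tr F + t² V)`. Here `F` is the compression
of multiplication by `f` to polynomials of degree below `n`, and `V = tr(compression of f²) - tr(F
Fᵀ)` is `statVar`.

For this bound, an orthogonal change of basis changes neither the squared determinant nor `tr F` nor
`V`, so `F` may be taken diagonal, with entries `l_i`. Andréief's identity turns `E exp(t (X_f - tr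
F))` into the determinant of a positive semidefinite matrix with diagonal entries `∫ exp(t (f -
l_i)) φ_i² dμ`. Since `l_i` is the mean of `f` under `φ_i² dμ`, the linear term drops out and each
entry is at most `1 + t² v_i`, with `v_i` the variance of `f` under that law. The `v_i` sum to `V`,
and `det N ≤ exp(tr N - n)` for positive semidefinite `N` (`det_le_exp_trace_sub_card`). The case of
small `t` of both signs identifies `E X_f` with `tr F`; Chernoff's bound then gives
`ensemble_deviation_le`.

It remains to bound `V`. Trivially `V ≤ n S²`, which gives I; Borel–Cantelli then needs no
information on the joint law. For II and III, `2 V` is the double integral of `(f(x) - f(y))² K_n(x,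
y)²`, so a pointwise comparison of `(f(x) - f(y))²` with `η + C (x - y)²` bounds `V` by `η n / 2 + C
(γ_{n-1}/γ_n)²`: the squared kernel has integral `n`, and the variance of `∑ x_j` is exactly
`(γ_{n-1}/γ_n)²` (`statVar_id`). Compact support bounds this ratio. -/

namespace OPE

/-! ### Determinants, Gram matrices and Andréief's identity -/

section Determinantal

variable {α ι : Type*} [Fintype ι]

lemma det_mul_det_eq_sum [DecidableEq ι] (φ ψ : ι → α → ℝ) (x : ι → α) :
    (Matrix.of fun i j => φ i (x j)).det * (Matrix.of fun i j => ψ i (x j)).det =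
      ∑ τ : Equiv.Perm ι, ∑ σ : Equiv.Perm ι, ((Equiv.Perm.sign τ : ℤ) : ℝ) *
        (((Equiv.Perm.sign σ : ℤ) : ℝ) * ∏ j, (φ (σ j) (x j) * ψ (τ j) (x j))) := by
  simp only [Matrix.det_apply', Matrix.of_apply, Finset.sum_mul_sum]
  rw [Finset.sum_comm]
  refine Finset.sum_congr rfl fun τ _ => Finset.sum_congr rfl fun σ _ => ?_
  rw [Finset.prod_mul_distrib]
  ring

variable [MeasurableSpace α] {μ : Measure α}

/-- The matrix of the integrals `∫ φ_i ψ_j dμ`. -/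
noncomputable def gramMatrix (μ : Measure α) (φ ψ : ι → α → ℝ) : Matrix ι ι ℝ :=
  Matrix.of fun i j => ∫ x, φ i x * ψ j x ∂μ

/-- The quadratic form at `v` is `∫ w (∑ v_i φ_i)² dμ`. -/
lemma posSemidef_gramMatrix {φ : ι → α → ℝ} {w : α → ℝ} (hw : ∀ x, 0 ≤ w x)
    (h : ∀ i j, Integrable (fun x => w x * φ i x * φ j x) μ) :
    (gramMatrix μ (fun i x => w x * φ i x) φ).PosSemidef := by
  refine Matrix.PosSemidef.of_dotProduct_mulVec_nonneg ?_ fun v => ?_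
  · ext i j
    simp only [gramMatrix, Matrix.conjTranspose_apply, Matrix.of_apply, star_trivial]
    exact integral_congr_ae (.of_forall fun x => by ring)
  · have : star v ⬝ᵥ (gramMatrix μ (fun i x => w x * φ i x) φ).mulVec v =
        ∫ x, w x * (∑ i, v i * φ i x) ^ 2 ∂μ := by
      have e : ∀ x, w x * (∑ i, v i * φ i x) ^ 2 =
          ∑ i, ∑ j, v i * (v j * (w x * φ i x * φ j x)) := fun x => by
        rw [sq, Finset.sum_mul_sum, Finset.mul_sum]
        refine Finset.sum_congr rfl fun i _ => ?_
        rw [Finset.mul_sum]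
        exact Finset.sum_congr rfl fun j _ => by ring
      simp only [e]
      rw [integral_finsetSum _ fun i _ => integrable_finsetSum _ fun j _ =>
        ((h i j).const_mul _).const_mul _]
      simp only [dotProduct, Matrix.mulVec, gramMatrix, Matrix.of_apply, star_trivial,
        Finset.mul_sum]
      refine Finset.sum_congr rfl fun i _ => ?_
      rw [integral_finsetSum _ fun j _ => ((h i j).const_mul _).const_mul _]
      refine Finset.sum_congr rfl fun j _ => ?_
      rw [integral_const_mul, integral_const_mul]
      ring
    rw [this]
    exact integral_nonneg fun x => mul_nonneg (hw x) (sq_nonneg _)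

variable [DecidableEq ι]

lemma integrable_det_mul_det [SigmaFinite μ] {φ ψ : ι → α → ℝ}
    (h : ∀ i j, Integrable (fun x => φ i x * ψ j x) μ) :
    Integrable (fun x : ι → α => (Matrix.of fun i j => φ i (x j)).det *
      (Matrix.of fun i j => ψ i (x j)).det) (Measure.pi fun _ => μ) := by
  simp only [det_mul_det_eq_sum]
  refine integrable_finsetSum _ fun τ _ => integrable_finsetSum _ fun σ _ => ?_
  exact ((Integrable.fintype_prod (f := fun j x => φ (σ j) x * ψ (τ j) x)
    fun j => h _ _).const_mul _).const_mul _

/-- Andréief's identity. -/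
theorem integral_det_mul_det [SigmaFinite μ] {φ ψ : ι → α → ℝ}
    (h : ∀ i j, Integrable (fun x => φ i x * ψ j x) μ) :
    ∫ x : ι → α, (Matrix.of fun i j => φ i (x j)).det *
      (Matrix.of fun i j => ψ i (x j)).det ∂(Measure.pi fun _ => μ) =
      (Fintype.card ι).factorial * (gramMatrix μ φ ψ).det := by
  have hI : ∀ σ τ : Equiv.Perm ι, Integrable
      (fun x : ι → α => ∏ j, (φ (σ j) (x j) * ψ (τ j) (x j))) (Measure.pi fun _ => μ) :=
    fun σ τ => Integrable.fintype_prod (f := fun j x => φ (σ j) x * ψ (τ j) x) fun j => h _ _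
  simp only [det_mul_det_eq_sum]
  rw [integral_finsetSum _ fun τ _ => integrable_finsetSum _ fun σ _ =>
    ((hI σ τ).const_mul _).const_mul _]
  have key : ∀ τ : Equiv.Perm ι, ∫ x : ι → α, ∑ σ : Equiv.Perm ι,
      ((Equiv.Perm.sign τ : ℤ) : ℝ) * (((Equiv.Perm.sign σ : ℤ) : ℝ) *
        ∏ j, (φ (σ j) (x j) * ψ (τ j) (x j))) ∂(Measure.pi fun _ => μ) =
      (gramMatrix μ φ ψ).det := by
    -- For fixed `τ`, Fubini makes the sum over `σ` the determinant of the Gram matrix with columns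
    -- permuted by `τ`. The sign this produces cancels `sign τ`, so each of the `n!` permutations
    -- `τ` contributes the same amount.
    intro τ
    rw [integral_finsetSum _ fun σ _ => ((hI σ τ).const_mul _).const_mul _]
    simp only [integral_const_mul]
    rw [← Finset.mul_sum]
    have : ∑ σ : Equiv.Perm ι, ((Equiv.Perm.sign σ : ℤ) : ℝ) *
        ∫ x : ι → α, ∏ j, (φ (σ j) (x j) * ψ (τ j) (x j)) ∂(Measure.pi fun _ => μ) =
        ((gramMatrix μ φ ψ).submatrix id τ).det := by
      rw [Matrix.det_apply']
      refine Finset.sum_congr rfl fun σ _ => ?_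
      rw [integral_fintype_prod_eq_prod (fun j x => φ (σ j) x * ψ (τ j) x)]
      simp [gramMatrix]
    rw [this, Matrix.det_permute', ← mul_assoc, ← Int.cast_mul, ← Units.val_mul,
      Int.units_mul_self]
    simp
  simp only [key, Finset.sum_const, Finset.card_univ, Fintype.card_perm, nsmul_eq_mul]

/-- Apply `x ≤ exp(x - 1)` to each eigenvalue; nonnegativity of the eigenvalues allows the
inequalities to be multiplied. -/
lemma det_le_exp_trace_sub_card {N : Matrix ι ι ℝ} (hN : N.PosSemidef) :
    N.det ≤ Real.exp (N.trace - Fintype.card ι) := by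
  rw [hN.isHermitian.det_eq_prod_eigenvalues, hN.isHermitian.trace_eq_sum_eigenvalues,
    ← Finset.card_univ, ← nsmul_one, ← Finset.sum_const, ← Finset.sum_sub_distrib, Real.exp_sum]
  refine Finset.prod_le_prod (fun i _ => hN.eigenvalues_nonneg i) fun i _ => ?_
  have := Real.add_one_le_exp (hN.isHermitian.eigenvalues i - 1)
  simpa using this

end Determinantal

/-! ### The Gaussian bound for exponential moments -/

section Determinantal

variable {α ι : Type*} [MeasurableSpace α] {μ : Measure α} [DecidableEq ι]

/-- The functions `φ_i` are orthonormal in `L²(μ)`. -/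
structure IsOrthonormalFamily (μ : Measure α) (φ : ι → α → ℝ) : Prop where
  integrable : ∀ i j, Integrable (fun x => φ i x * φ j x) μ
  integral : ∀ i j, ∫ x, φ i x * φ j x ∂μ = if i = j then 1 else 0

/-- The matrix of the compression of multiplication by `g` to the span of the `φ_i`. -/
noncomputable def compression {α ι : Type*} [MeasurableSpace α] (μ : Measure α) (φ : ι → α → ℝ)
    (g : α → ℝ) : Matrix ι ι ℝ :=
  Matrix.of fun i j => ∫ x, g x * (φ i x * φ j x) ∂μ

/-- The variance of `∑ f(x_j)` in the determinantal ensemble spanned by the `φ_i`. -/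
noncomputable def statVar {α ι : Type*} [MeasurableSpace α] [Fintype ι] (μ : Measure α)
    (φ : ι → α → ℝ) (f : α → ℝ) : ℝ :=
  (compression μ φ fun x => f x ^ 2).trace -
    (compression μ φ f * (compression μ φ f).transpose).trace

lemma statVar_eq {α ι : Type*} [MeasurableSpace α] [Fintype ι] (μ : Measure α)
    (φ : ι → α → ℝ) (f : α → ℝ) : statVar μ φ f =
      ∑ i, ∫ x, f x ^ 2 * (φ i x * φ i x) ∂μ -
        ∑ i, ∑ j, (∫ x, f x * (φ i x * φ j x) ∂μ) ^ 2 := by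
  simp [statVar, compression, Matrix.trace, Matrix.mul_apply, sq]

lemma exp_le_one_add_add_sq {u : ℝ} (hu : |u| ≤ 1) : Real.exp u ≤ 1 + u + u ^ 2 := by
  have := (abs_le.1 (Real.abs_exp_sub_one_sub_id_le hu)).2
  linarith

/-- Integrate `exp u ≤ 1 + u + u²` with `u = t (f - l)` against the probability measure `φ_i² dμ`,
whose mean of `f` is `l`: the linear term vanishes and the quadratic one is `t²` times the variance.
As `|f - l| ≤ 2 S`, the condition on `t` ensures `|u| ≤ 1`. -/
lemma IsOrthonormalFamily.integral_exp_mul_sq_le {φ : ι → α → ℝ} (hφ : IsOrthonormalFamily μ φ)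
    {f : α → ℝ} (hf : AEStronglyMeasurable f μ) {S : ℝ} (hS : ∀ᵐ x ∂μ, |f x| ≤ S)
    {t : ℝ} (ht : 3 * S * |t| ≤ 1) (i : ι) :
    ∫ x, Real.exp (t * (f x - ∫ y, f y * (φ i y * φ i y) ∂μ)) * (φ i x * φ i x) ∂μ ≤
      1 + t ^ 2 * (∫ x, f x ^ 2 * (φ i x * φ i x) ∂μ -
        (∫ y, f y * (φ i y * φ i y) ∂μ) ^ 2) := by
  set l := ∫ y, f y * (φ i y * φ i y) ∂μ with hl
  have h0 := hφ.integrable i i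
  have h00 : ∫ x, φ i x * φ i x ∂μ = 1 := by simpa using hφ.integral i i
  have h1 : Integrable (fun x => f x * (φ i x * φ i x)) μ := h0.bdd_mul hf hS
  have h2 : Integrable (fun x => f x ^ 2 * (φ i x * φ i x)) μ :=
    h0.bdd_mul (hf.pow 2) (c := S ^ 2) (by
      filter_upwards [hS] with x hx
      rw [Real.norm_eq_abs, abs_pow]
      exact pow_le_pow_left₀ (abs_nonneg _) hx 2)
  have hlS : |l| ≤ S := by
    rw [hl]
    refine (abs_integral_le_integral_abs).trans ?_
    calc ∫ x, |f x * (φ i x * φ i x)| ∂μ ≤ ∫ x, S * (φ i x * φ i x) ∂μ := by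
          refine integral_mono_ae h1.abs (h0.const_mul _) ?_
          filter_upwards [hS] with x hx
          rw [abs_mul, abs_mul_self (φ i x)]
          exact mul_le_mul_of_nonneg_right hx (mul_self_nonneg _)
      _ = S := by rw [integral_const_mul, h00, mul_one]
  have hu : ∀ᵐ x ∂μ, |t * (f x - l)| ≤ 1 := by
    filter_upwards [hS] with x hx
    rw [abs_mul]
    have h3 : |f x - l| ≤ 2 * S := (abs_sub _ _).trans (by linarith)
    have h4 : 0 ≤ S := (abs_nonneg _).trans hlS
    have := mul_le_mul_of_nonneg_left h3 (abs_nonneg t)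
    have := mul_nonneg h4 (abs_nonneg t)
    nlinarith
  have hexp : Integrable (fun x => Real.exp (t * (f x - l)) * (φ i x * φ i x)) μ := by
    refine h0.bdd_mul (c := Real.exp 1) ?_ ?_
    · exact Real.continuous_exp.comp_aestronglyMeasurable
        ((hf.sub aestronglyMeasurable_const).const_mul t)
    · filter_upwards [hu] with x hx
      rw [Real.norm_eq_abs, Real.abs_exp]
      exact Real.exp_le_exp.2 ((le_abs_self _).trans hx)
  have e : ∀ x, (1 + t * (f x - l) + (t * (f x - l)) ^ 2) * (φ i x * φ i x) =
      (1 - t * l + t ^ 2 * l ^ 2) * (φ i x * φ i x) +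
        ((t - 2 * t ^ 2 * l) * (f x * (φ i x * φ i x)) +
          t ^ 2 * (f x ^ 2 * (φ i x * φ i x))) := fun x => by ring
  have hint' : Integrable (fun x => (t - 2 * t ^ 2 * l) * (f x * (φ i x * φ i x)) +
      t ^ 2 * (f x ^ 2 * (φ i x * φ i x))) μ := (h1.const_mul _).add (h2.const_mul _)
  have hint : Integrable (fun x => (1 - t * l + t ^ 2 * l ^ 2) * (φ i x * φ i x) +
        ((t - 2 * t ^ 2 * l) * (f x * (φ i x * φ i x)) +
          t ^ 2 * (f x ^ 2 * (φ i x * φ i x)))) μ := (h0.const_mul _).add hint'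
  calc ∫ x, Real.exp (t * (f x - l)) * (φ i x * φ i x) ∂μ
      ≤ ∫ x, (1 + t * (f x - l) + (t * (f x - l)) ^ 2) * (φ i x * φ i x) ∂μ := by
        refine integral_mono_ae hexp (hint.congr (.of_forall fun x => (e x).symm)) ?_
        filter_upwards [hu] with x hx
        exact mul_le_mul_of_nonneg_right (exp_le_one_add_add_sq hx) (mul_self_nonneg _)
    _ = 1 + t ^ 2 * (∫ x, f x ^ 2 * (φ i x * φ i x) ∂μ - l ^ 2) := by
        simp only [e]
        rw [integral_add (h0.const_mul _) hint',
          integral_add (h1.const_mul _) (h2.const_mul _), integral_const_mul,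
          integral_const_mul, integral_const_mul, h00, ← hl]
        ring

variable [Fintype ι]

/-- Diagonality is what makes the one-function variances of `f` under `φ_i² dμ` add up to `statVar`;
in general their sum is larger by the squares of the off-diagonal entries. -/
lemma IsOrthonormalFamily.integral_exp_mul_det_sq_le_of_diagonal [SigmaFinite μ]
    {φ : ι → α → ℝ} (hφ : IsOrthonormalFamily μ φ)
    {f : α → ℝ} (hf : AEStronglyMeasurable f μ) {S : ℝ} (hS : ∀ᵐ x ∂μ, |f x| ≤ S)
    {t : ℝ} (ht : 3 * S * |t| ≤ 1)
    (hdiag : ∀ i j, i ≠ j → ∫ x, f x * (φ i x * φ j x) ∂μ = 0) :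
    ∫ x : ι → α, Real.exp (t * ∑ j, f (x j)) * (Matrix.of fun i j => φ i (x j)).det ^ 2
        ∂(Measure.pi fun _ => μ) ≤
      (Fintype.card ι).factorial *
        Real.exp (t * (compression μ φ f).trace + t ^ 2 * statVar μ φ f) := by
  set l : ι → ℝ := fun i => ∫ x, f x * (φ i x * φ i x) ∂μ with hl
  -- Half of the centering `exp(-t l_i)` goes on each side of the Gram matrix, so that it stays
  -- symmetric and its diagonal is centered entry by entry.
  set c : ι → ℝ := fun i => Real.exp (-(t * l i) / 2) with hc
  set ψ : ι → α → ℝ := fun i x => c i * φ i x with hψ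
  have hexp : ∀ i j, Integrable (fun x => Real.exp (t * f x) * ψ i x * ψ j x) μ := by
    intro i j
    have h := ((hφ.integrable i j).bdd_mul (f := fun x => Real.exp (t * f x))
      (c := Real.exp (|t| * S)) ?_ ?_).const_mul (c i * c j)
    · refine h.congr (.of_forall fun x => ?_)
      simp only [hψ]
      ring
    · exact Real.continuous_exp.comp_aestronglyMeasurable (hf.const_mul t)
    · filter_upwards [hS] with x hx
      rw [Real.norm_eq_abs, Real.abs_exp]
      refine Real.exp_le_exp.2 ((le_abs_self _).trans ?_)
      rw [abs_mul]
      exact mul_le_mul_of_nonneg_left hx (abs_nonneg _)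
  have hpt : ∀ x : ι → α, Real.exp (t * ∑ j, f (x j)) *
      (Matrix.of fun i j => φ i (x j)).det ^ 2 = Real.exp (t * ∑ i, l i) *
        ((Matrix.of fun i j => Real.exp (t * f (x j)) * ψ i (x j)).det *
          (Matrix.of fun i j => ψ i (x j)).det) := by
    intro x
    have h1 : (Matrix.of fun i j => ψ i (x j)).det =
        (∏ i, c i) * (Matrix.of fun i j => φ i (x j)).det :=
      Matrix.det_mul_column c (Matrix.of fun i j => φ i (x j))
    have h2 : (Matrix.of fun i j => Real.exp (t * f (x j)) * ψ i (x j)).det =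
        (∏ j, Real.exp (t * f (x j))) * (Matrix.of fun i j => ψ i (x j)).det :=
      Matrix.det_mul_row (fun j => Real.exp (t * f (x j))) (Matrix.of fun i j => ψ i (x j))
    have h3 : Real.exp (t * ∑ i, l i) * (∏ i, c i) ^ 2 = 1 := by
      rw [hc, ← Real.exp_sum, ← Real.exp_nat_mul, ← Real.exp_add, Real.exp_eq_one_iff,
        ← Finset.sum_div, Finset.sum_neg_distrib, ← Finset.mul_sum]
      push_cast
      ring
    rw [h2, h1, Finset.mul_sum, Real.exp_sum]
    linear_combination (-(∏ j, Real.exp (t * f (x j))) *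
      (Matrix.of fun i j => φ i (x j)).det ^ 2) * h3
  simp only [hpt]
  rw [integral_const_mul, integral_det_mul_det hexp]
  have hpos := posSemidef_gramMatrix (fun x => (Real.exp_pos (t * f x)).le) hexp
  have htr : (gramMatrix μ (fun i x => Real.exp (t * f x) * ψ i x) ψ).trace -
      Fintype.card ι ≤ t ^ 2 * statVar μ φ f := by
    have e1 : (gramMatrix μ (fun i x => Real.exp (t * f x) * ψ i x) ψ).trace =
        ∑ i, ∫ x, Real.exp (t * (f x - l i)) * (φ i x * φ i x) ∂μ := by
      simp only [Matrix.trace, Matrix.diag, gramMatrix, Matrix.of_apply]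
      refine Finset.sum_congr rfl fun i _ => integral_congr_ae (.of_forall fun x => ?_)
      have : Real.exp (t * (f x - l i)) = Real.exp (t * f x) * (c i * c i) := by
        rw [hc, ← Real.exp_add, ← Real.exp_add]
        ring_nf
      simp only [hψ, this]
      ring
    have e2 : statVar μ φ f = ∑ i, (∫ x, f x ^ 2 * (φ i x * φ i x) ∂μ - l i ^ 2) := by
      rw [statVar_eq, Finset.sum_sub_distrib]
      congr 1
      refine Finset.sum_congr rfl fun i _ => ?_
      rw [Finset.sum_eq_single i]
      · intro j _ hj
        rw [hdiag i j hj.symm, zero_pow two_ne_zero]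
      · simp
    rw [e1, e2, sub_le_iff_le_add, Finset.mul_sum, ← Finset.card_univ, ← nsmul_one,
      ← Finset.sum_const, ← Finset.sum_add_distrib]
    refine Finset.sum_le_sum fun i _ => ?_
    rw [add_comm]
    exact hφ.integral_exp_mul_sq_le hf hS ht i
  have hdet := (det_le_exp_trace_sub_card hpos).trans (Real.exp_le_exp.2 htr)
  have e3 : (compression μ φ f).trace = ∑ i, l i := rfl
  rw [e3, Real.exp_add]
  calc _ = ((Fintype.card ι).factorial * Real.exp (t * ∑ i, l i)) *
        (gramMatrix μ (fun i x => Real.exp (t * f x) * ψ i x) ψ).det := by ring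
    _ ≤ ((Fintype.card ι).factorial * Real.exp (t * ∑ i, l i)) *
        Real.exp (t ^ 2 * statVar μ φ f) := by gcongr
    _ = _ := by ring

/-- The family `∑_k U_{ki} φ_k`. -/
def rotate {α ι : Type*} [Fintype ι] (U : Matrix ι ι ℝ) (φ : ι → α → ℝ) : ι → α → ℝ :=
  fun i x => ∑ k, U k i * φ k x

lemma compression_rotate {α ι : Type*} [MeasurableSpace α] {μ : Measure α} [Fintype ι]
    (U : Matrix ι ι ℝ) {φ : ι → α → ℝ} {g : α → ℝ}
    (h : ∀ i j, Integrable (fun x => g x * (φ i x * φ j x)) μ) :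
    compression μ (rotate U φ) g = U.transpose * compression μ φ g * U := by
  ext i j
  have e : ∀ x, g x * (rotate U φ i x * rotate U φ j x) =
      ∑ l, ∑ k, U k i * U l j * (g x * (φ k x * φ l x)) := fun x => by
    simp only [rotate]
    rw [Finset.sum_mul_sum, Finset.sum_comm, Finset.mul_sum]
    refine Finset.sum_congr rfl fun l _ => ?_
    rw [Finset.mul_sum]
    exact Finset.sum_congr rfl fun k _ => by ring
  simp only [compression, Matrix.of_apply, e, Matrix.mul_apply, Matrix.transpose_apply]
  rw [integral_finsetSum _ fun l _ => integrable_finsetSum _ fun k _ => (h k l).const_mul _]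
  refine Finset.sum_congr rfl fun l _ => ?_
  rw [integral_finsetSum _ fun k _ => (h k l).const_mul _, Finset.sum_mul]
  refine Finset.sum_congr rfl fun k _ => ?_
  rw [integral_const_mul]
  ring

lemma integrable_rotate {α ι : Type*} [MeasurableSpace α] {μ : Measure α} [Fintype ι]
    (U : Matrix ι ι ℝ) {φ : ι → α → ℝ}
    (h : ∀ i j, Integrable (fun x => φ i x * φ j x) μ) (i j : ι) :
    Integrable (fun x => rotate U φ i x * rotate U φ j x) μ := by
  simp only [rotate, Finset.sum_mul_sum]
  refine integrable_finsetSum _ fun k _ => integrable_finsetSum _ fun l _ => ?_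
  refine ((h k l).const_mul (U k i * U l j)).congr (.of_forall fun x => ?_)
  ring

/-- The exponential moments of `∑ f(x_j)` in a determinantal ensemble are bounded by those of a
Gaussian variable with a comparable variance. -/
theorem IsOrthonormalFamily.integral_exp_mul_det_sq_le [SigmaFinite μ]
    {φ : ι → α → ℝ} (hφ : IsOrthonormalFamily μ φ)
    {f : α → ℝ} (hf : AEStronglyMeasurable f μ) {S : ℝ} (hS : ∀ᵐ x ∂μ, |f x| ≤ S)
    {t : ℝ} (ht : 3 * S * |t| ≤ 1) :
    ∫ x : ι → α, Real.exp (t * ∑ j, f (x j)) * (Matrix.of fun i j => φ i (x j)).det ^ 2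
        ∂(Measure.pi fun _ => μ) ≤
      (Fintype.card ι).factorial *
        Real.exp (t * (compression μ φ f).trace + t ^ 2 * statVar μ φ f) := by
  -- The spectral theorem supplies the rotation that reduces to the diagonal case.
  have hF : (compression μ φ f).IsHermitian := by
    ext i j
    simp only [compression, Matrix.conjTranspose_apply, Matrix.of_apply, star_trivial]
    exact integral_congr_ae (.of_forall fun x => by ring)
  set U : Matrix ι ι ℝ := (hF.eigenvectorUnitary : Matrix ι ι ℝ) with hU
  have hU1 : U.transpose * U = 1 := by
    have := Unitary.coe_star_mul_self hF.eigenvectorUnitary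
    rwa [Matrix.star_eq_conjTranspose, Matrix.conjTranspose_eq_transpose_of_trivial] at this
  have hU2 : U * U.transpose = 1 := mul_eq_one_comm.1 hU1
  have hD : U.transpose * compression μ φ f * U = Matrix.diagonal hF.eigenvalues := by
    have := hF.conjStarAlgAut_star_eigenvectorUnitary
    rw [Unitary.conjStarAlgAut_star_apply, Matrix.star_eq_conjTranspose,
      Matrix.conjTranspose_eq_transpose_of_trivial] at this
    exact this
  have hi1 : ∀ i j, Integrable (fun x => f x * (φ i x * φ j x)) μ :=
    fun i j => (hφ.integrable i j).bdd_mul hf hS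
  have hi2 : ∀ i j, Integrable (fun x => f x ^ 2 * (φ i x * φ j x)) μ :=
    fun i j => (hφ.integrable i j).bdd_mul (hf.pow 2) (c := S ^ 2) (by
      filter_upwards [hS] with x hx
      rw [Real.norm_eq_abs, abs_pow]
      exact pow_le_pow_left₀ (abs_nonneg _) hx 2)
  have hr : IsOrthonormalFamily μ (rotate U φ) := by
    refine ⟨integrable_rotate U hφ.integrable, fun i j => ?_⟩
    -- Orthonormality says that the compression of the constant `1` is the identity matrix, and
    -- conjugation by `U` preserves this.
    have h1 := compression_rotate (μ := μ) U (φ := φ) (g := fun _ => 1)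
      (by simpa using hφ.integrable)
    have h2 : compression μ φ (fun _ => 1) = 1 := by
      ext i j
      simp [compression, hφ.integral, Matrix.one_apply]
    rw [h2, mul_one, hU1] at h1
    simpa [compression, Matrix.one_apply] using congrFun (congrFun h1 i) j
  have hc1 := compression_rotate U hi1
  have hc2 := compression_rotate U hi2
  have key := hr.integral_exp_mul_det_sq_le_of_diagonal hf hS ht (fun i j hij => by
    have := congrFun (congrFun (hc1.trans hD) i) j
    rwa [Matrix.diagonal_apply_ne _ hij] at this)
  have htr : ∀ M : Matrix ι ι ℝ, (U.transpose * M * U).trace = M.trace := fun M => by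
    rw [Matrix.trace_mul_comm, ← mul_assoc, hU2, one_mul]
  have hvar : statVar μ (rotate U φ) f = statVar μ φ f := by
    rw [statVar, statVar, hc1, hc2, htr]
    congr 1
    rw [Matrix.transpose_mul, Matrix.transpose_mul, Matrix.transpose_transpose,
      ← htr (compression μ φ f * (compression μ φ f).transpose)]
    congr 1
    calc U.transpose * compression μ φ f * U * (U.transpose * ((compression μ φ f).transpose * U))
        = U.transpose * compression μ φ f * (U * U.transpose) *
          (compression μ φ f).transpose * U := by simp only [mul_assoc]
      _ = _ := by rw [hU2]; simp only [mul_assoc, mul_one]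
  have hdet : ∀ x : ι → α, (Matrix.of fun i j => rotate U φ i (x j)).det ^ 2 =
      (Matrix.of fun i j => φ i (x j)).det ^ 2 := fun x => by
    have : (Matrix.of fun i j => rotate U φ i (x j)) =
        U.transpose * Matrix.of fun i j => φ i (x j) := by
      ext i j
      simp [rotate, Matrix.mul_apply]
    have h1 : U.det ^ 2 = 1 := by
      have := congrArg Matrix.det hU1
      rwa [Matrix.det_mul, Matrix.det_transpose, Matrix.det_one, ← sq] at this
    rw [this, Matrix.det_mul, Matrix.det_transpose, mul_pow, h1, one_mul]
  simp only [hdet] at key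
  rwa [hvar, hc1, htr] at key

end Determinantal

/-! ### The ensemble as a determinantal measure, and its concentration -/

section Ensemble

variable {μ : Measure ℝ} {n : ℕ}

lemma HasFiniteMoments.isFiniteMeasure (h : HasFiniteMoments μ) : IsFiniteMeasure μ := by
  have := h 0
  simp only [pow_zero] at this
  rcases integrable_const_iff.1 this with h | h
  · exact absurd h one_ne_zero
  · exact h

/-- The orthonormal polynomials of degree less than `n`, as functions. -/
noncomputable def orthoFun (μ : Measure ℝ) (n : ℕ) : Fin n → ℝ → ℝ :=
  fun i x => (orthoPoly μ i).eval x

lemma HasFiniteMoments.integrable_mul (h : HasFiniteMoments μ) (p q : ℝ[X]) :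
    Integrable (fun x => p.eval x * q.eval x) μ := by
  simpa using h.integrable_eval (p * q)

lemma integral_orthoPoly_mul (h : HasFiniteMoments μ) {i j : ℕ}
    (hi : (i : ℕ∞) < μ.support.encard) (hj : (j : ℕ∞) < μ.support.encard) :
    ∫ x, (orthoPoly μ i).eval x * (orthoPoly μ j).eval x ∂μ = if i = j then 1 else 0 := by
  rcases le_total j i with hc | hc
  · rw [(orthoPoly_spec h hi).2.2 j hc]
    simp only [eq_comm]
  · rw [← (orthoPoly_spec h hj).2.2 i hc]
    simp only [mul_comm]

lemma isOrthonormalFamily_orthoFun (h : HasFiniteMoments μ) (hn : (n : ℕ∞) ≤ μ.support.encard) :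
    IsOrthonormalFamily μ (orthoFun μ n) := by
  refine ⟨fun i j => h.integrable_mul _ _, fun i j => ?_⟩
  have hlt : ∀ i : Fin n, ((i : ℕ) : ℕ∞) < μ.support.encard := fun i =>
    lt_of_lt_of_le (by exact_mod_cast i.2) hn
  simp only [orthoFun, integral_orthoPoly_mul h (hlt i) (hlt j), Fin.ext_iff]

lemma vandermondeSq_eq_det_sq (x : Fin n → ℝ) :
    vandermondeSq x = (Matrix.vandermonde x).det ^ 2 := by
  rw [Matrix.det_vandermonde, vandermondeSq]
  simp only [Finset.prod_pow]
  congr 1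
  exact Finset.prod_comm' (by simp)

/-- Passing from monomials to monic polynomials leaves the Vandermonde determinant unchanged;
normalizing the rows only contributes a positive factor. -/
lemma exists_det_orthoFun_eq (h : HasFiniteMoments μ) (hn : (n : ℕ∞) ≤ μ.support.encard) :
    ∃ c : ℝ, 0 < c ∧ ∀ x : Fin n → ℝ,
      (Matrix.of fun i j => orthoFun μ n i (x j)).det ^ 2 = c * vandermondeSq x := by
  have hlt : ∀ i : Fin n, ((i : ℕ) : ℕ∞) < μ.support.encard := fun i =>
    lt_of_lt_of_le (by exact_mod_cast i.2) hn
  refine ⟨(∏ i : Fin n, (Real.sqrt (∫ x, (monicPoly μ i).eval x ^ 2 ∂μ))⁻¹) ^ 2, ?_, fun x => ?_⟩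
  · refine pow_pos (Finset.prod_pos fun i _ => ?_) 2
    have := integral_monicPoly_sq_pos h (hlt i)
    positivity
  · rw [vandermondeSq_eq_det_sq, Matrix.det_eval_matrixOfPolynomials_eq_det_vandermonde x
      (fun i => monicPoly μ i)
      (fun i => natDegree_eq_of_degree_eq_some (monicPoly_monic_degree μ i).2)
      (fun i => (monicPoly_monic_degree μ i).1), ← mul_pow]
    congr 1
    have h1 := Matrix.det_mul_column
      (fun i : Fin n => (Real.sqrt (∫ x, (monicPoly μ i).eval x ^ 2 ∂μ))⁻¹)
      (Matrix.of fun i j => (monicPoly μ i).eval (x j))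
    rw [← Matrix.det_transpose (Matrix.of fun i j : Fin n => (monicPoly μ j).eval (x i))]
    refine Eq.trans ?_ h1
    simp [orthoFun, orthoPoly]

lemma measurable_vandermondeSq : Measurable (vandermondeSq : (Fin n → ℝ) → ℝ) := by
  unfold vandermondeSq
  fun_prop

lemma vandermondeSq_nonneg (x : Fin n → ℝ) : 0 ≤ vandermondeSq x :=
  Finset.prod_nonneg fun _ _ => Finset.prod_nonneg fun _ _ => sq_nonneg _

lemma ensemble_eq (h : HasFiniteMoments μ) (hn : (n : ℕ∞) ≤ μ.support.encard) :
    ensemble μ n = (Measure.pi fun _ : Fin n => μ).withDensity fun x => ENNReal.ofReal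
      ((n.factorial : ℝ)⁻¹ * (Matrix.of fun i j => orthoFun μ n i (x j)).det ^ 2) := by
  have := h.isFiniteMeasure
  obtain ⟨c, hc, hdet⟩ := exists_det_orthoFun_eq h hn
  have hO := isOrthonormalFamily_orthoFun h hn
  have hfac : (0 : ℝ) < n.factorial := by exact_mod_cast n.factorial_pos
  have hint := integrable_det_mul_det hO.integrable
  have hval := integral_det_mul_det hO.integrable
  have hg : gramMatrix μ (orthoFun μ n) (orthoFun μ n) = 1 := by
    ext i j
    simp [gramMatrix, hO.integral, Matrix.one_apply]
  simp only [← sq, hdet] at hint hval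
  rw [hg, Matrix.det_one, mul_one, Fintype.card_fin, integral_const_mul] at hval
  have hint' : Integrable (vandermondeSq : (Fin n → ℝ) → ℝ) (Measure.pi fun _ => μ) := by
    refine (hint.const_mul c⁻¹).congr (.of_forall fun x => ?_)
    simp only
    field_simp
  -- By Andréief's identity with an identity Gram matrix, `c` times the total mass is `n!`.
  have hZ : unnormalizedEnsemble μ n Set.univ = ENNReal.ofReal (n.factorial / c) := by
    rw [unnormalizedEnsemble, withDensity_apply _ MeasurableSet.univ, Measure.restrict_univ,
      ← ofReal_integral_eq_lintegral_ofReal hint' (.of_forall vandermondeSq_nonneg), ← hval]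
    congr 1
    field_simp
  rw [ensemble, hZ, unnormalizedEnsemble, ← withDensity_smul _
    (measurable_vandermondeSq.ennreal_ofReal)]
  congr 1
  ext x
  rw [Pi.smul_apply, smul_eq_mul, ← ENNReal.ofReal_inv_of_pos (by positivity),
    ← ENNReal.ofReal_mul (by positivity), hdet]
  congr 1
  field_simp

lemma measurable_orthoFun (i : Fin n) : Measurable (orthoFun μ n i) :=
  (orthoPoly μ i).continuous.measurable

lemma measurable_det_orthoFun :
    Measurable fun x : Fin n → ℝ => (Matrix.of fun i j => orthoFun μ n i (x j)).det := by
  simp only [Matrix.det_apply', Matrix.of_apply]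
  have : ∀ i j : Fin n, Measurable fun x : Fin n → ℝ => orthoFun μ n i (x j) :=
    fun i j => (measurable_orthoFun i).comp (measurable_pi_apply j)
  fun_prop

lemma integral_ensemble (h : HasFiniteMoments μ) (hn : (n : ℕ∞) ≤ μ.support.encard)
    (g : (Fin n → ℝ) → ℝ) : ∫ x, g x ∂(ensemble μ n) =
      (n.factorial : ℝ)⁻¹ * ∫ x, g x * (Matrix.of fun i j => orthoFun μ n i (x j)).det ^ 2
        ∂(Measure.pi fun _ => μ) := by
  rw [ensemble_eq h hn, integral_withDensity_eq_integral_toReal_smul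
    ((measurable_det_orthoFun.pow_const 2).const_mul _).ennreal_ofReal
    (.of_forall fun x => ENNReal.ofReal_lt_top), ← integral_const_mul]
  refine integral_congr_ae (.of_forall fun x => ?_)
  simp only
  rw [ENNReal.toReal_ofReal (by positivity), smul_eq_mul]
  ring

lemma isProbabilityMeasure_ensemble (h : HasFiniteMoments μ)
    (hn : (n : ℕ∞) ≤ μ.support.encard) : IsProbabilityMeasure (ensemble μ n) := by
  have := h.isFiniteMeasure
  have hO := isOrthonormalFamily_orthoFun h hn
  have hfac : (0 : ℝ) < n.factorial := by exact_mod_cast n.factorial_pos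
  have hint := integrable_det_mul_det hO.integrable
  have hval := integral_det_mul_det hO.integrable
  have hg : gramMatrix μ (orthoFun μ n) (orthoFun μ n) = 1 := by
    ext i j
    simp [gramMatrix, hO.integral, Matrix.one_apply]
  simp only [← sq] at hint hval
  rw [hg, Matrix.det_one, mul_one, Fintype.card_fin] at hval
  refine ⟨?_⟩
  rw [ensemble_eq h hn, withDensity_apply _ MeasurableSet.univ, Measure.restrict_univ,
    ← ofReal_integral_eq_lintegral_ofReal (hint.const_mul _) (.of_forall fun x => by positivity),
    integral_const_mul, hval, inv_mul_cancel₀ hfac.ne', ENNReal.ofReal_one]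

lemma ae_ensemble_forall (h : HasFiniteMoments μ) {p : ℝ → Prop} (hp : ∀ᵐ x ∂μ, p x) :
    ∀ᵐ x ∂(ensemble μ n), ∀ j, p (x j) := by
  have := h.isFiniteMeasure
  have h1 : ∀ᵐ x ∂(Measure.pi fun _ : Fin n => μ), ∀ j, p (x j) :=
    ae_all_iff.2 fun j => (Measure.tendsto_eval_ae_ae (μ := fun _ : Fin n => μ) (i := j)).eventually hp
  have h2 : ensemble μ n ≪ Measure.pi fun _ : Fin n => μ :=
    (withDensity_absolutelyContinuous _ _).smul_left _
  exact h2.ae_le h1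

lemma measurable_linStat {f : ℝ → ℝ} (hf : Measurable f) :
    Measurable (linStat f : (Fin n → ℝ) → ℝ) := by
  unfold linStat
  fun_prop

lemma ae_abs_linStat_le (h : HasFiniteMoments μ) {f : ℝ → ℝ} {S : ℝ}
    (hS : ∀ᵐ x ∂μ, |f x| ≤ S) : ∀ᵐ x ∂(ensemble μ n), |linStat f x| ≤ n * S := by
  filter_upwards [ae_ensemble_forall h hS] with x hx
  refine (Finset.abs_sum_le_sum_abs _ _).trans ((Finset.sum_le_sum fun j _ => hx j).trans ?_)
  simp

lemma integrable_exp_linStat (h : HasFiniteMoments μ) (hn : (n : ℕ∞) ≤ μ.support.encard)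
    {f : ℝ → ℝ} (hf : Measurable f) {S : ℝ} (hS : ∀ᵐ x ∂μ, |f x| ≤ S) (t : ℝ) :
    Integrable (fun x : Fin n → ℝ => Real.exp (t * linStat f x)) (ensemble μ n) := by
  have := isProbabilityMeasure_ensemble h hn
  refine Integrable.of_bound (C := Real.exp (|t| * (n * S)))
    ((measurable_linStat hf).const_mul t).exp.aestronglyMeasurable ?_
  filter_upwards [ae_abs_linStat_le h hS] with x hx
  rw [Real.norm_eq_abs, Real.abs_exp]
  refine Real.exp_le_exp.2 ((le_abs_self _).trans ?_)
  rw [abs_mul]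
  exact mul_le_mul_of_nonneg_left hx (abs_nonneg _)

lemma integrable_linStat (h : HasFiniteMoments μ) (hn : (n : ℕ∞) ≤ μ.support.encard)
    {f : ℝ → ℝ} (hf : Measurable f) {S : ℝ} (hS : ∀ᵐ x ∂μ, |f x| ≤ S) :
    Integrable (linStat f : (Fin n → ℝ) → ℝ) (ensemble μ n) := by
  have := isProbabilityMeasure_ensemble h hn
  exact Integrable.of_bound (measurable_linStat hf).aestronglyMeasurable _
    (ae_abs_linStat_le h hS)

lemma mgf_linStat_le (h : HasFiniteMoments μ) (hn : (n : ℕ∞) ≤ μ.support.encard)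
    {f : ℝ → ℝ} (hf : Measurable f) {S : ℝ} (hS : ∀ᵐ x ∂μ, |f x| ≤ S)
    {t : ℝ} (ht : 3 * S * |t| ≤ 1) :
    mgf (linStat f) (ensemble μ n) t ≤ Real.exp (t * (compression μ (orthoFun μ n) f).trace +
      t ^ 2 * statVar μ (orthoFun μ n) f) := by
  have := h.isFiniteMeasure
  have hfac : (0 : ℝ) < n.factorial := by exact_mod_cast n.factorial_pos
  have key := (isOrthonormalFamily_orthoFun h hn).integral_exp_mul_det_sq_le
    hf.aestronglyMeasurable hS ht
  rw [Fintype.card_fin] at key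
  rw [mgf, integral_ensemble h hn]
  rwa [inv_mul_le_iff₀ hfac]

/-- If `1 + t a ≤ exp (t² V)` for all small `t`, of both signs, then `a = 0`. -/
lemma eq_zero_of_exp_bound {a V δ : ℝ} (hδ : 0 < δ)
    (h : ∀ t, |t| ≤ δ → 1 + t * a ≤ Real.exp (t ^ 2 * V)) : a = 0 := by
  have hf : HasDerivAt (fun t : ℝ => Real.exp (t ^ 2 * V) - (1 + t * a))
      (Real.exp ((0 : ℝ) ^ 2 * V) * ((2 : ℕ) * (0 : ℝ) ^ (2 - 1) * V) - 1 * a) 0 :=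
    (((hasDerivAt_pow 2 (0 : ℝ)).mul_const V).exp).sub
      (((hasDerivAt_id (0 : ℝ)).mul_const a).const_add 1)
  have hmin : IsLocalMin (fun t : ℝ => Real.exp (t ^ 2 * V) - (1 + t * a)) 0 := by
    filter_upwards [Metric.closedBall_mem_nhds (0 : ℝ) hδ] with t ht
    have := h t (by simpa using ht)
    simp only [ne_eq, OfNat.ofNat_ne_zero, not_false_eq_true, zero_pow, zero_mul, Real.exp_zero,
      add_zero, sub_self]
    linarith
  have := hmin.hasDerivAt_eq_zero hf
  simpa using this

/-- No separate computation of the one-point density is made: `1 + u ≤ exp u` and the Gaussian bound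
squeeze the mean, as the first-order term in `t` must vanish. -/
lemma meanLinStat_eq (h : HasFiniteMoments μ) (hn : (n : ℕ∞) ≤ μ.support.encard)
    {f : ℝ → ℝ} (hf : Measurable f) {S : ℝ} (hS : ∀ᵐ x ∂μ, |f x| ≤ S) :
    meanLinStat μ n f = (compression μ (orthoFun μ n) f).trace := by
  have := isProbabilityMeasure_ensemble h hn
  set T := (compression μ (orthoFun μ n) f).trace with hT
  rw [← sub_eq_zero]
  -- The `+ 1` keeps the radius finite when `S = 0`.
  refine eq_zero_of_exp_bound (V := statVar μ (orthoFun μ n) f)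
    (δ := 1 / (3 * (|S| + 1))) (by positivity) fun t ht => ?_
  have ht' : 3 * S * |t| ≤ 1 := by
    rw [le_div_iff₀ (by positivity)] at ht
    have := mul_le_mul_of_nonneg_right (le_abs_self S) (abs_nonneg t)
    nlinarith [abs_nonneg t]
  have h1 := mgf_linStat_le h hn hf hS ht'
  have hi := integrable_linStat h hn hf hS
  have hi1 : Integrable (fun x : Fin n → ℝ => t * (linStat f x - T)) (ensemble μ n) :=
    (hi.sub (integrable_const _)).const_mul t
  calc 1 + t * (meanLinStat μ n f - T)
      = ∫ x, (1 + t * (linStat f x - T)) ∂(ensemble μ n) := by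
        rw [integral_add (integrable_const _) hi1, integral_const_mul,
          integral_sub hi (integrable_const _), meanLinStat]
        simp
    _ ≤ ∫ x, Real.exp (-(t * T)) * Real.exp (t * linStat f x) ∂(ensemble μ n) := by
        refine integral_mono ((integrable_const _).add hi1)
          ((integrable_exp_linStat h hn hf hS t).const_mul _) fun x => ?_
        simp only
        rw [← Real.exp_add]
        have := Real.add_one_le_exp (-(t * T) + t * linStat f x)
        linarith
    _ = Real.exp (-(t * T)) * mgf (linStat f) (ensemble μ n) t := integral_const_mul _ _
    _ ≤ Real.exp (-(t * T)) * Real.exp (t * T + t ^ 2 * statVar μ (orthoFun μ n) f) := by gcongr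
    _ = Real.exp (t ^ 2 * statVar μ (orthoFun μ n) f) := by
        rw [← Real.exp_add]
        congr 1
        ring

/-- Concentration of linear statistics with a rate `s` limited by the variance and the size
of `f`. -/
theorem ensemble_deviation_le (h : HasFiniteMoments μ) (hn : (n : ℕ∞) ≤ μ.support.encard)
    {f : ℝ → ℝ} (hf : Measurable f) {S : ℝ} (hS : ∀ᵐ x ∂μ, |f x| ≤ S)
    {ε s : ℝ} (hs : 0 ≤ s) (h1 : 4 * statVar μ (orthoFun μ n) f * s ≤ ε) (h2 : 6 * S * s ≤ 1) :
    ensemble μ n {x | ε ≤ |linStat f x - meanLinStat μ n f|} ≤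
      2 * ENNReal.ofReal (Real.exp (-(ε * s))) := by
  have := isProbabilityMeasure_ensemble h hn
  set V := statVar μ (orthoFun μ n) f with hV
  set m := meanLinStat μ n f with hm
  have hT := meanLinStat_eq h hn hf hS
  -- Chernoff's exponent at `t = ± 2 s`: the hypothesis `4 V s ≤ ε` makes the quadratic term `4 s²
  -- V` at most half of the gain `2 s ε`. The condition `6 S s ≤ 1` is `3 S |t| ≤ 1`.
  have hexp : (2 * s) ^ 2 * V - 2 * s * ε ≤ -(ε * s) := by
    have := mul_le_mul_of_nonneg_right h1 hs
    nlinarith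
  have ha : |2 * s| = 2 * s := abs_of_nonneg (by linarith)
  have hup : (ensemble μ n).real {x | m + ε ≤ linStat f x} ≤ Real.exp (-(ε * s)) := by
    refine (measure_ge_le_exp_mul_mgf (t := 2 * s) (m + ε) (by linarith)
      (integrable_exp_linStat h hn hf hS _)).trans ?_
    refine (mul_le_mul_of_nonneg_left (mgf_linStat_le h hn hf hS (t := 2 * s)
      (by rw [ha]; linarith)) (Real.exp_pos _).le).trans ?_
    rw [← Real.exp_add, ← hT, ← hm]
    refine Real.exp_le_exp.2 (le_trans (le_of_eq ?_) hexp)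
    ring
  have hlo : (ensemble μ n).real {x | linStat f x ≤ m - ε} ≤ Real.exp (-(ε * s)) := by
    refine (measure_le_le_exp_mul_mgf (t := -(2 * s)) (m - ε) (by linarith)
      (integrable_exp_linStat h hn hf hS _)).trans ?_
    refine (mul_le_mul_of_nonneg_left (mgf_linStat_le h hn hf hS (t := -(2 * s))
      (by rw [abs_neg, ha]; linarith)) (Real.exp_pos _).le).trans ?_
    rw [← Real.exp_add, ← hT, ← hm]
    refine Real.exp_le_exp.2 (le_trans (le_of_eq ?_) hexp)
    ring
  have hsub : {x : Fin n → ℝ | ε ≤ |linStat f x - m|} ⊆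
      {x | m + ε ≤ linStat f x} ∪ {x | linStat f x ≤ m - ε} := by
    intro x hx
    rcases le_abs.1 (show ε ≤ |linStat f x - m| from hx) with hx | hx
    · exact Or.inl (show m + ε ≤ linStat f x by linarith)
    · exact Or.inr (show linStat f x ≤ m - ε by linarith)
  have conv : ∀ s : Set (Fin n → ℝ), ∀ r : ℝ, (ensemble μ n).real s ≤ r →
      ensemble μ n s ≤ ENNReal.ofReal r := fun s r hr => by
    rw [← ofReal_measureReal]
    exact ENNReal.ofReal_le_ofReal hr
  rw [two_mul]
  exact (measure_mono hsub).trans ((measure_union_le _ _).trans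
    (add_le_add (conv _ _ hup) (conv _ _ hlo)))

end Ensemble

/-! ### Bounds for the variance -/

section Variance

/-- The subtracted sum of squares is dropped, and each remaining integral is at most `S²` by
normalization. -/
lemma IsOrthonormalFamily.statVar_le {α ι : Type*} [MeasurableSpace α] {μ : Measure α}
    [Fintype ι] [DecidableEq ι] {φ : ι → α → ℝ} (hφ : IsOrthonormalFamily μ φ)
    {f : α → ℝ} (hf : AEStronglyMeasurable f μ) {S : ℝ} (hS : ∀ᵐ x ∂μ, |f x| ≤ S) :
    statVar μ φ f ≤ Fintype.card ι * S ^ 2 := by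
  rw [statVar_eq]
  have hb : ∀ᵐ x ∂μ, f x ^ 2 ≤ S ^ 2 := by
    filter_upwards [hS] with x hx
    rw [← sq_abs]
    exact pow_le_pow_left₀ (abs_nonneg _) hx 2
  have h1 : ∀ i, ∫ x, f x ^ 2 * (φ i x * φ i x) ∂μ ≤ S ^ 2 := fun i => by
    have h0 := hφ.integrable i i
    calc ∫ x, f x ^ 2 * (φ i x * φ i x) ∂μ ≤ ∫ x, S ^ 2 * (φ i x * φ i x) ∂μ := by
          refine integral_mono_ae (h0.bdd_mul (hf.pow 2) (c := S ^ 2) ?_) (h0.const_mul _) ?_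
          · filter_upwards [hb] with x hx
            rwa [Real.norm_eq_abs, abs_of_nonneg (sq_nonneg _)]
          · filter_upwards [hb] with x hx
            exact mul_le_mul_of_nonneg_right hx (mul_self_nonneg _)
      _ = S ^ 2 := by rw [integral_const_mul, hφ.integral]; simp
  have h2 : 0 ≤ ∑ i, ∑ j, (∫ x, f x * (φ i x * φ j x) ∂μ) ^ 2 :=
    Finset.sum_nonneg fun i _ => Finset.sum_nonneg fun j _ => sq_nonneg _
  have h3 := Finset.sum_le_sum fun i (_ : i ∈ Finset.univ) => h1 i
  rw [Finset.sum_const, nsmul_eq_mul, Finset.card_univ] at h3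
  linarith

section Kernel

variable {α ι : Type*} [MeasurableSpace α] {μ : Measure α} [SigmaFinite μ]
    [Fintype ι] {φ : ι → α → ℝ}

/-- Expanding the square of the kernel gives a double sum of products of a function of each
variable, to which Fubini applies. -/
lemma hasIntegral_mul_kernel_sq {g h : α → ℝ}
    (hg : ∀ i j, Integrable (fun x => g x * (φ i x * φ j x)) μ)
    (hh : ∀ i j, Integrable (fun x => h x * (φ i x * φ j x)) μ) :
    Integrable (fun z : α × α => g z.1 * h z.2 * (∑ i, φ i z.1 * φ i z.2) ^ 2) (μ.prod μ) ∧
    ∫ z : α × α, g z.1 * h z.2 * (∑ i, φ i z.1 * φ i z.2) ^ 2 ∂(μ.prod μ) =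
      ∑ i, ∑ j, (∫ x, g x * (φ i x * φ j x) ∂μ) * ∫ x, h x * (φ i x * φ j x) ∂μ := by
  have e : ∀ z : α × α, g z.1 * h z.2 * (∑ i, φ i z.1 * φ i z.2) ^ 2 =
      ∑ i, ∑ j, (g z.1 * (φ i z.1 * φ j z.1)) * (h z.2 * (φ i z.2 * φ j z.2)) := fun z => by
    rw [sq, Finset.sum_mul_sum, Finset.mul_sum]
    refine Finset.sum_congr rfl fun i _ => ?_
    rw [Finset.mul_sum]
    exact Finset.sum_congr rfl fun j _ => by ring
  have hI := fun i j => (hg i j).mul_prod (hh i j)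
  simp only [e]
  refine ⟨integrable_finsetSum _ fun i _ => integrable_finsetSum _ fun j _ => hI i j, ?_⟩
  rw [integral_finsetSum _ fun i _ => integrable_finsetSum _ fun j _ => hI i j]
  refine Finset.sum_congr rfl fun i _ => ?_
  rw [integral_finsetSum _ fun j _ => hI i j]
  exact Finset.sum_congr rfl fun j _ =>
    integral_prod_mul (fun x => g x * (φ i x * φ j x)) (fun x => h x * (φ i x * φ j x))

variable [DecidableEq ι]

lemma IsOrthonormalFamily.integral_kernel_sq (hφ : IsOrthonormalFamily μ φ) :
    Integrable (fun z : α × α => (∑ i, φ i z.1 * φ i z.2) ^ 2) (μ.prod μ) ∧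
    ∫ z : α × α, (∑ i, φ i z.1 * φ i z.2) ^ 2 ∂(μ.prod μ) = Fintype.card ι := by
  have h1 : ∀ i j, Integrable (fun x => (1 : ℝ) * (φ i x * φ j x)) μ := by
    simpa using hφ.integrable
  have := hasIntegral_mul_kernel_sq (g := fun _ => 1) (h := fun _ => 1) h1 h1
  simpa [hφ.integral] using this

/-- The variance as a double integral. -/
lemma IsOrthonormalFamily.integral_sq_sub_mul_kernel_sq (hφ : IsOrthonormalFamily μ φ)
    {f : α → ℝ} (h1 : ∀ i j, Integrable (fun x => f x * (φ i x * φ j x)) μ)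
    (h2 : ∀ i j, Integrable (fun x => f x ^ 2 * (φ i x * φ j x)) μ) :
    Integrable (fun z : α × α => (f z.1 - f z.2) ^ 2 * (∑ i, φ i z.1 * φ i z.2) ^ 2)
      (μ.prod μ) ∧
    ∫ z : α × α, (f z.1 - f z.2) ^ 2 * (∑ i, φ i z.1 * φ i z.2) ^ 2 ∂(μ.prod μ) =
      2 * statVar μ φ f := by
  have h0 : ∀ i j, Integrable (fun x => (1 : ℝ) * (φ i x * φ j x)) μ := by
    simpa using hφ.integrable
  obtain ⟨ha, ha'⟩ := hasIntegral_mul_kernel_sq (g := fun x => f x ^ 2) (h := fun _ => 1) h2 h0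
  obtain ⟨hb, hb'⟩ := hasIntegral_mul_kernel_sq (g := fun _ => 1) (h := fun x => f x ^ 2) h0 h2
  obtain ⟨hc, hc'⟩ := hasIntegral_mul_kernel_sq h1 h1
  have e : ∀ z : α × α, (f z.1 - f z.2) ^ 2 * (∑ i, φ i z.1 * φ i z.2) ^ 2 =
      f z.1 ^ 2 * 1 * (∑ i, φ i z.1 * φ i z.2) ^ 2 +
        1 * f z.2 ^ 2 * (∑ i, φ i z.1 * φ i z.2) ^ 2 -
        2 * (f z.1 * f z.2 * (∑ i, φ i z.1 * φ i z.2) ^ 2) := fun z => by ring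
  have hab : Integrable (fun z : α × α => f z.1 ^ 2 * 1 * (∑ i, φ i z.1 * φ i z.2) ^ 2 +
        1 * f z.2 ^ 2 * (∑ i, φ i z.1 * φ i z.2) ^ 2) (μ.prod μ) := ha.add hb
  simp only [e]
  refine ⟨hab.sub (hc.const_mul _), ?_⟩
  rw [integral_sub hab (hc.const_mul _), integral_add ha hb, integral_const_mul, ha', hb', hc',
    statVar_eq]
  simp only [one_mul, hφ.integral, mul_ite, mul_one, mul_zero, ite_mul, zero_mul,
    Finset.sum_ite_eq, Finset.mem_univ, if_true, ← sq]
  ring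

/-- Both variances are integrals against the same positive weight, the squared kernel, whose total
mass is the number of functions. -/
lemma IsOrthonormalFamily.statVar_le_of_sq_sub_le (hφ : IsOrthonormalFamily μ φ)
    {f g : α → ℝ} (hf1 : ∀ i j, Integrable (fun x => f x * (φ i x * φ j x)) μ)
    (hf2 : ∀ i j, Integrable (fun x => f x ^ 2 * (φ i x * φ j x)) μ)
    (hg1 : ∀ i j, Integrable (fun x => g x * (φ i x * φ j x)) μ)
    (hg2 : ∀ i j, Integrable (fun x => g x ^ 2 * (φ i x * φ j x)) μ)
    {η C : ℝ} (hfg : ∀ᵐ z ∂(μ.prod μ), (f z.1 - f z.2) ^ 2 ≤ η + C * (g z.1 - g z.2) ^ 2) :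
    statVar μ φ f ≤ η / 2 * Fintype.card ι + C * statVar μ φ g := by
  obtain ⟨hk, hk'⟩ := hφ.integral_kernel_sq
  obtain ⟨hf, hf'⟩ := hφ.integral_sq_sub_mul_kernel_sq hf1 hf2
  obtain ⟨hg, hg'⟩ := hφ.integral_sq_sub_mul_kernel_sq hg1 hg2
  have key : 2 * statVar μ φ f ≤ η * Fintype.card ι + C * (2 * statVar μ φ g) := by
    rw [← hf', ← hg', ← hk', ← integral_const_mul, ← integral_const_mul,
      ← integral_add (hk.const_mul _) (hg.const_mul _)]
    refine integral_mono_ae hf ((hk.const_mul _).add (hg.const_mul _)) ?_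
    filter_upwards [hfg] with z hz
    have := mul_le_mul_of_nonneg_right hz (sq_nonneg (∑ i, φ i z.1 * φ i z.2))
    linarith
  linarith

end Kernel

/-! ### Expansions in orthonormal polynomials and the Jacobi coefficient -/

variable {μ : Measure ℝ} {n : ℕ}

lemma exists_eq_sum_orthoPoly (h : HasFiniteMoments μ) {m : ℕ}
    (hm : (m : ℕ∞) ≤ μ.support.encard) {q : ℝ[X]} (hq : q.degree < m) :
    ∃ c : ℕ → ℝ, q = ∑ j ∈ Finset.range m, C (c j) * orthoPoly μ j := by
  induction m generalizing q with
  | zero => exact ⟨0, by simpa using hq⟩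
  | succ m ih =>
    have hlt : (m : ℕ∞) < μ.support.encard :=
      lt_of_lt_of_le (by exact_mod_cast m.lt_succ_self) hm
    obtain ⟨hd, hl, -⟩ := orthoPoly_spec h hlt
    have hcoeff : (orthoPoly μ m).coeff m = leadCoeff μ m := by
      rw [leadCoeff, leadingCoeff, hd]
    obtain ⟨c, hc⟩ := ih hlt.le (q := q - C (q.coeff m / leadCoeff μ m) * orthoPoly μ m) (by
      rw [degree_lt_iff_coeff_zero]
      intro k hk
      rw [coeff_sub, coeff_C_mul]
      rcases hk.eq_or_lt with rfl | hk
      · rw [hcoeff, div_mul_cancel₀ _ hl.ne', sub_self]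
      · rw [coeff_eq_zero_of_natDegree_lt (hd.trans_lt hk), mul_zero, sub_zero]
        exact (degree_lt_iff_coeff_zero _ _).1 hq k hk)
    refine ⟨Function.update c m (q.coeff m / leadCoeff μ m), ?_⟩
    rw [Finset.sum_range_succ, Function.update_self, ← sub_eq_iff_eq_add, hc]
    refine Finset.sum_congr rfl fun j hj => ?_
    rw [Function.update_of_ne (Finset.mem_range.1 hj).ne]

lemma integral_sum_mul_orthoPoly (h : HasFiniteMoments μ) {m : ℕ}
    (hm : (m : ℕ∞) ≤ μ.support.encard) (c : ℕ → ℝ) {k : ℕ} (hk : (k : ℕ∞) < μ.support.encard) :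
    ∫ x, (∑ j ∈ Finset.range m, C (c j) * orthoPoly μ j).eval x * (orthoPoly μ k).eval x ∂μ =
      if k < m then c k else 0 := by
  simp only [eval_finsetSum, eval_mul, eval_C, Finset.sum_mul, mul_assoc]
  rw [integral_finsetSum _ fun j _ => (h.integrable_mul _ _).const_mul _]
  have : ∀ j ∈ Finset.range m, ∫ x, c j * ((orthoPoly μ j).eval x * (orthoPoly μ k).eval x) ∂μ =
      if j = k then c j else 0 := fun j hj => by
    rw [integral_const_mul, integral_orthoPoly_mul h
      (lt_of_lt_of_le (by exact_mod_cast Finset.mem_range.1 hj) hm) hk, mul_ite, mul_one, mul_zero]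
  rw [Finset.sum_congr rfl this, Finset.sum_ite_eq']
  simp

/-- Parseval's identity in the finite-dimensional space of polynomials of degree below `m`. -/
lemma integral_sq_eq_sum (h : HasFiniteMoments μ) {m : ℕ}
    (hm : (m : ℕ∞) ≤ μ.support.encard) {q : ℝ[X]} (hq : q.degree < m) :
    ∫ x, q.eval x ^ 2 ∂μ =
      ∑ j ∈ Finset.range m, (∫ x, q.eval x * (orthoPoly μ j).eval x ∂μ) ^ 2 := by
  obtain ⟨c, hc⟩ := exists_eq_sum_orthoPoly h hm hq
  have e : ∀ x, q.eval x ^ 2 =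
      ∑ j ∈ Finset.range m, c j * (q.eval x * (orthoPoly μ j).eval x) := fun x => by
    rw [sq]
    nth_rewrite 2 [hc]
    simp only [eval_finsetSum, eval_mul, eval_C, Finset.mul_sum]
    exact Finset.sum_congr rfl fun j _ => by ring
  simp only [e]
  rw [integral_finsetSum _ fun j _ => (h.integrable_mul _ _).const_mul _]
  refine Finset.sum_congr rfl fun j hj => ?_
  have hj' := Finset.mem_range.1 hj
  have : ∫ x, q.eval x * (orthoPoly μ j).eval x ∂μ = c j := by
    rw [hc, integral_sum_mul_orthoPoly h hm c (lt_of_lt_of_le (by exact_mod_cast hj') hm),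
      if_pos hj']
  rw [integral_const_mul, this, sq]

lemma degree_X_mul_orthoPoly_lt (h : HasFiniteMoments μ) {i m : ℕ}
    (hi : (i : ℕ∞) < μ.support.encard) (him : i + 1 < m) : (X * orthoPoly μ i).degree < (m : WithBot ℕ) := by
  refine (degree_le_natDegree).trans_lt ?_
  have := natDegree_mul_le (p := (X : ℝ[X])) (q := orthoPoly μ i)
  rw [natDegree_X, (orthoPoly_spec h hi).1] at this
  exact_mod_cast (this.trans_lt (by omega))

/-- The Jacobi coefficient `∫ x p_{n-1}(x) p_n(x) dμ(x)` is the ratio of the leading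
coefficients. -/
lemma integral_X_mul_orthoPoly_succ (h : HasFiniteMoments μ) {k : ℕ}
    (hk : ((k + 1 : ℕ) : ℕ∞) < μ.support.encard) :
    ∫ x, (X * orthoPoly μ k).eval x * (orthoPoly μ (k + 1)).eval x ∂μ =
      leadCoeff μ k / leadCoeff μ (k + 1) := by
  have hk0 : (k : ℕ∞) < μ.support.encard := lt_trans (by exact_mod_cast k.lt_succ_self) hk
  have hk2 : ((k + 2 : ℕ) : ℕ∞) ≤ μ.support.encard := by
    have := Order.add_one_le_of_lt hk
    exact_mod_cast this
  obtain ⟨c, hc⟩ := exists_eq_sum_orthoPoly h hk2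
    (degree_X_mul_orthoPoly_lt h hk0 (m := k + 2) (by omega))
  obtain ⟨hd, hl, -⟩ := orthoPoly_spec h hk
  rw [hc, integral_sum_mul_orthoPoly h hk2 c hk, if_pos (by omega), eq_div_iff hl.ne']
  -- Compare the coefficients of `X ^ (k + 1)`: on the right only the last polynomial of the
  -- expansion reaches this degree.
  have h1 := congrArg (fun q => coeff q (k + 1)) hc
  simp only [coeff_X_mul, finsetSum_coeff, coeff_C_mul] at h1
  rw [Finset.sum_range_succ, Finset.sum_eq_zero, zero_add] at h1
  · have e1 : (orthoPoly μ (k + 1)).coeff (k + 1) = leadCoeff μ (k + 1) := by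
      rw [leadCoeff, leadingCoeff, hd]
    have e2 : (orthoPoly μ k).coeff k = leadCoeff μ k := by
      rw [leadCoeff, leadingCoeff, (orthoPoly_spec h hk0).1]
    rw [← e1, ← e2, h1]
  · intro j hj
    have hj' := Finset.mem_range.1 hj
    have : (j : ℕ∞) < μ.support.encard := lt_trans (by exact_mod_cast hj') hk
    rw [coeff_eq_zero_of_natDegree_lt ((orthoPoly_spec h this).1.trans_lt hj'), mul_zero]

/-- The variance of `∑ x_j` is the square of the Jacobi coefficient. -/
lemma statVar_id (h : HasFiniteMoments μ) (hn1 : 1 ≤ n) (hn : (n : ℕ∞) < μ.support.encard) :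
    statVar μ (orthoFun μ n) (fun x => x) = (leadCoeff μ (n - 1) / leadCoeff μ n) ^ 2 := by
  obtain ⟨k, rfl⟩ : ∃ k, n = k + 1 := ⟨n - 1, by omega⟩
  have hlt : ∀ i < k + 1, (i : ℕ∞) < μ.support.encard := fun i hi =>
    lt_trans (by exact_mod_cast hi) hn
  have hk2 : ((k + 2 : ℕ) : ℕ∞) ≤ μ.support.encard := by
    have := Order.add_one_le_of_lt hn
    exact_mod_cast this
  -- Parseval for `x p_i`, of degree at most `k + 1`: the sum over `j ≤ k` misses exactly the
  -- component along `p_{k+1}`.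
  have key : ∀ i < k + 1, ∫ x, x ^ 2 * ((orthoPoly μ i).eval x * (orthoPoly μ i).eval x) ∂μ -
      ∑ j : Fin (k + 1), (∫ x, x * ((orthoPoly μ i).eval x * (orthoPoly μ j).eval x) ∂μ) ^ 2 =
      (∫ x, (X * orthoPoly μ i).eval x * (orthoPoly μ (k + 1)).eval x ∂μ) ^ 2 := by
    intro i hi
    have h1 := integral_sq_eq_sum h hk2
      (degree_X_mul_orthoPoly_lt h (hlt i hi) (m := k + 2) (by omega))
    rw [Finset.sum_range_succ, Finset.sum_range] at h1
    have e1 : ∀ x, x ^ 2 * ((orthoPoly μ i).eval x * (orthoPoly μ i).eval x) =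
        (X * orthoPoly μ i).eval x ^ 2 := fun x => by
      rw [eval_mul, eval_X]; ring
    have e2 : ∀ (j : ℕ) (x : ℝ), x * ((orthoPoly μ i).eval x * (orthoPoly μ j).eval x) =
        (X * orthoPoly μ i).eval x * (orthoPoly μ j).eval x := fun j x => by
      rw [eval_mul, eval_X]; ring
    simp only [e1, e2]
    rw [h1]
    ring
  rw [statVar_eq, ← Finset.sum_sub_distrib]
  refine (Finset.sum_congr rfl fun (i : Fin (k + 1)) _ => key i i.2).trans ?_
  rw [Fin.sum_univ_castSucc, Finset.sum_eq_zero, zero_add, Fin.val_last,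
    integral_X_mul_orthoPoly_succ h hn, Nat.add_sub_cancel]
  -- For `i < k` the polynomial `x p_i` has degree at most `k`, hence no component along `p_{k+1}`.
  -- Only `i = k` contributes.
  intro i _
  rw [Fin.val_castSucc]
  have hi' := i.2
  obtain ⟨c, hc⟩ := exists_eq_sum_orthoPoly h hn.le
    (degree_X_mul_orthoPoly_lt h (hlt i (by omega)) (m := k + 1) (by omega))
  rw [hc, integral_sum_mul_orthoPoly h hn.le c hn, if_neg (lt_irrefl _), zero_pow two_ne_zero]

lemma ae_mem_support_prod [SFinite μ] :
    ∀ᵐ z ∂(μ.prod μ), z.1 ∈ μ.support ∧ z.2 ∈ μ.support := by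
  have h : ∀ᵐ x ∂μ, x ∈ μ.support := Measure.support_mem_ae
  exact (Measure.quasiMeasurePreserving_fst.ae h).and (Measure.quasiMeasurePreserving_snd.ae h)

/-- The variance of a linear statistic is controlled by the Jacobi coefficient and a modulus of
continuity. -/
theorem statVar_orthoFun_le (h : HasFiniteMoments μ) (hn1 : 1 ≤ n)
    (hn : (n : ℕ∞) < μ.support.encard) {f : ℝ → ℝ} (hf : Measurable f) {S : ℝ}
    (hS : ∀ᵐ x ∂μ, |f x| ≤ S) {η C : ℝ}
    (hfg : ∀ x ∈ μ.support, ∀ y ∈ μ.support, (f x - f y) ^ 2 ≤ η + C * (x - y) ^ 2) :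
    statVar μ (orthoFun μ n) f ≤
      η / 2 * n + C * (leadCoeff μ (n - 1) / leadCoeff μ n) ^ 2 := by
  have := h.isFiniteMeasure
  have hO := isOrthonormalFamily_orthoFun h hn.le
  rw [← statVar_id h hn1 hn]
  have hX : ∀ k : ℕ, ∀ i j : Fin n,
      Integrable (fun x => x ^ k * (orthoFun μ n i x * orthoFun μ n j x)) μ := fun k i j => by
    simpa [orthoFun] using h.integrable_mul (X ^ k) (orthoPoly μ i * orthoPoly μ j)
  have := hO.statVar_le_of_sq_sub_le (f := f) (g := fun x => x) (η := η) (C := C)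
    (fun i j => (hO.integrable i j).bdd_mul hf.aestronglyMeasurable hS)
    (fun i j => (hO.integrable i j).bdd_mul (hf.aestronglyMeasurable.pow 2) (c := S ^ 2) (by
      filter_upwards [hS] with x hx
      rw [Real.norm_eq_abs, abs_pow]
      exact pow_le_pow_left₀ (abs_nonneg _) hx 2))
    (by simpa using hX 1) (hX 2) (by
      filter_upwards [ae_mem_support_prod (μ := μ)] with z hz
      exact hfg _ hz.1 _ hz.2)
  rwa [Fintype.card_fin] at this

/-- The Jacobi coefficients of a measure supported in `[-R, R]` are at most `R`. -/
lemma leadCoeff_div_sq_le (h : HasFiniteMoments μ) {k : ℕ}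
    (hk : ((k + 1 : ℕ) : ℕ∞) < μ.support.encard) {R : ℝ} (hR : ∀ x ∈ μ.support, |x| ≤ R) :
    (leadCoeff μ k / leadCoeff μ (k + 1)) ^ 2 ≤ R ^ 2 := by
  have hk0 : (k : ℕ∞) < μ.support.encard := lt_trans (by exact_mod_cast k.lt_succ_self) hk
  rw [← integral_X_mul_orthoPoly_succ h hk, ← sq_abs]
  refine pow_le_pow_left₀ (abs_nonneg _) (abs_integral_le_integral_abs.trans ?_) 2
  have hi1 := h.integrable_mul (orthoPoly μ k) (orthoPoly μ k)
  have hi2 := h.integrable_mul (orthoPoly μ (k + 1)) (orthoPoly μ (k + 1))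
  have hs : ∀ᵐ x ∂μ, x ∈ μ.support := Measure.support_mem_ae
  -- Use `|x| ≤ R` on the support and `2 |a b| ≤ a² + b²`; the two squares have integral `1`.
  calc ∫ x, |(X * orthoPoly μ k).eval x * (orthoPoly μ (k + 1)).eval x| ∂μ
      ≤ ∫ x, (R / 2 * ((orthoPoly μ k).eval x * (orthoPoly μ k).eval x) +
        R / 2 * ((orthoPoly μ (k + 1)).eval x * (orthoPoly μ (k + 1)).eval x)) ∂μ := by
        refine integral_mono_ae (h.integrable_mul _ _).abs
          ((hi1.const_mul _).add (hi2.const_mul _)) ?_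
        filter_upwards [hs] with x hx
        have h0 := hR x hx
        simp only [eval_mul, eval_X]
        set a := (orthoPoly μ k).eval x
        set b := (orthoPoly μ (k + 1)).eval x
        rw [abs_mul, abs_mul, mul_assoc]
        have h1 := mul_le_mul_of_nonneg_right h0 (mul_nonneg (abs_nonneg a) (abs_nonneg b))
        have h2 := two_mul_le_add_sq |a| |b|
        rw [sq_abs, sq_abs] at h2
        have h3 := mul_le_mul_of_nonneg_left h2 ((abs_nonneg x).trans h0)
        nlinarith
    _ = R := by
        rw [integral_add (hi1.const_mul _) (hi2.const_mul _), integral_const_mul,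
          integral_const_mul, integral_orthoPoly_mul h hk0 hk0, integral_orthoPoly_mul h hk hk]
        simp

end Variance

/-! ### From real rates to the extended-valued bounds -/

section Bounds

lemma expNeg_coe (r : ℝ≥0) : expNeg r = ENNReal.ofReal (Real.exp (-(r : ℝ))) := by
  rw [expNeg, ← EReal.exp_coe]
  rfl

lemma expNeg_top : expNeg ∞ = 0 := by
  simp [expNeg]

/-- Reduces an extended rate `r` to real ones. If `r = ∞`, as happens when `‖f‖_∞ = 0` in a
denominator, letting `s → ∞` gives `p = 0`. -/
lemma le_two_mul_expNeg_mul {p : ℝ≥0∞} {ε : ℝ≥0} (hε : 0 < ε) {r : ℝ≥0∞}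
    (hp : ∀ s : ℝ≥0, (s : ℝ≥0∞) ≤ r → p ≤ 2 * ENNReal.ofReal (Real.exp (-(ε * s : ℝ)))) :
    p ≤ 2 * expNeg (ε * r) := by
  induction r with
  | coe s =>
    rw [← ENNReal.coe_mul, expNeg_coe]
    simpa using hp s le_rfl
  | top =>
    rw [ENNReal.mul_top (by simpa using hε.ne'), expNeg_top, mul_zero]
    have h1 : Tendsto (fun k : ℕ => Real.exp (-(ε * (k : ℝ≥0) : ℝ))) atTop (𝓝 0) := by
      refine Real.tendsto_exp_neg_atTop_nhds_zero.comp ?_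
      simpa using tendsto_natCast_atTop_atTop.const_mul_atTop (NNReal.coe_pos.2 hε)
    have h2 := ENNReal.Tendsto.const_mul (a := 2) (ENNReal.tendsto_ofReal h1)
      (Or.inr ENNReal.ofNat_ne_top)
    rw [ENNReal.ofReal_zero, mul_zero] at h2
    exact ge_of_tendsto' h2 fun k => hp k le_top

lemma ae_abs_le_supNorm {μ : Measure ℝ} {f : ℝ → ℝ} (h : supNorm μ f ≠ ∞) :
    ∀ᵐ x ∂μ, |f x| ≤ (supNorm μ f).toReal := by
  filter_upwards [enorm_ae_le_eLpNormEssSup f μ] with x hx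
  rw [← eLpNorm_exponent_top, ← supNorm] at hx
  have := ENNReal.toReal_mono h hx
  rwa [toReal_enorm, Real.norm_eq_abs] at this

variable {μ : Measure ℝ} {n : ℕ}

/-- If `‖f‖_∞ = ∞`, the second condition forces `s = 0` and the bound is the trivial `2`; this
covers unbounded Lipschitz functions. -/
lemma ensemble_deviation_le_of_supNorm (h : HasFiniteMoments μ)
    (hn : (n : ℕ∞) ≤ μ.support.encard) {f : ℝ → ℝ} (hf : Measurable f) {ε : ℝ} {s : ℝ≥0}
    (h1 : supNorm μ f ≠ ∞ → 4 * statVar μ (orthoFun μ n) f * s ≤ ε)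
    (h2 : s * (6 * supNorm μ f) ≤ 1) :
    ensemble μ n {x | ε ≤ |linStat f x - meanLinStat μ n f|} ≤
      2 * ENNReal.ofReal (Real.exp (-(ε * s))) := by
  by_cases hS : supNorm μ f = ∞
  · have := isProbabilityMeasure_ensemble h hn
    have hs : s = 0 := by
      by_contra hs
      rw [hS, ENNReal.mul_top (by simp), ENNReal.mul_top (by simpa using hs)] at h2
      simp at h2
    refine prob_le_one.trans ?_
    simp [hs]
  · refine ensemble_deviation_le h hn hf (ae_abs_le_supNorm hS) s.2 (h1 hS) ?_
    have := ENNReal.toReal_mono ENNReal.one_ne_top h2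
    simp only [ENNReal.toReal_mul, ENNReal.coe_toReal, ENNReal.toReal_ofNat,
      ENNReal.toReal_one] at this
    linarith

lemma setOf_le_abs_div_sub_div (hn : 1 ≤ n) (f : ℝ → ℝ) (ε m : ℝ) :
    {x : Fin n → ℝ | ε ≤ |1 / (n : ℝ) * linStat f x - 1 / (n : ℝ) * m|} =
      {x | n * ε ≤ |linStat f x - m|} := by
  have hpos : (0 : ℝ) < n := by exact_mod_cast hn
  ext x
  simp only [Set.mem_ofPred_eq]
  rw [← mul_sub, abs_mul, abs_of_pos (by positivity), one_div, ← div_eq_inv_mul,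
    le_div_iff₀ hpos, mul_comm]

lemma statVar_orthoFun_le_supNorm (h : HasFiniteMoments μ) (hn : (n : ℕ∞) ≤ μ.support.encard)
    {f : ℝ → ℝ} (hf : Measurable f) (hS : supNorm μ f ≠ ∞) :
    statVar μ (orthoFun μ n) f ≤ n * (supNorm μ f).toReal ^ 2 := by
  simpa using (isOrthonormalFamily_orthoFun h hn).statVar_le hf.aestronglyMeasurable
    (ae_abs_le_supNorm hS)

/-- The concentration inequality for averages of bounded functions. -/
theorem ensemble_average_deviation_le (hn1 : 1 ≤ n) (h : HasFiniteMoments μ)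
    (hn : (n : ℕ∞) ≤ μ.support.encard) {f : ℝ → ℝ} (hf : Measurable f) {ε : ℝ≥0} (hε : 0 < ε) :
    ensemble μ n {x | (ε : ℝ) ≤ |1 / (n : ℝ) * linStat f x - 1 / (n : ℝ) * meanLinStat μ n f|} ≤
      2 * expNeg ((n : ℝ≥0∞) * ε *
        min ((ε : ℝ≥0∞) / (8 * (1 : ℝ≥0) * supNorm μ f ^ 2)) (1 / (6 * supNorm μ f))) := by
  have hpos : (0 : ℝ) < n := by exact_mod_cast hn1
  have hcoe : (n : ℝ≥0∞) * ε = ((n * ε : ℝ≥0) : ℝ≥0∞) := by simp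
  rw [setOf_le_abs_div_sub_div hn1, hcoe]
  refine le_two_mul_expNeg_mul (mul_pos (by exact_mod_cast hn1) hε) fun s hs => ?_
  obtain ⟨hs1, hs2⟩ := le_min_iff.1 hs
  rw [ENNReal.le_div_iff_mul_le (Or.inr (by simpa using hε.ne')) (Or.inr ENNReal.coe_ne_top)] at hs1
  rw [ENNReal.le_div_iff_mul_le (Or.inr one_ne_zero) (Or.inr ENNReal.one_ne_top)] at hs2
  have := ensemble_deviation_le_of_supNorm h hn hf (ε := n * ε) (s := s) (fun hS => ?_) hs2
  · simpa using this
  · have h1 := ENNReal.toReal_mono ENNReal.coe_ne_top hs1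
    simp only [ENNReal.toReal_mul, ENNReal.coe_toReal, ENNReal.toReal_ofNat,
      ENNReal.toReal_pow, NNReal.coe_one, mul_one] at h1
    have h2 := mul_le_mul_of_nonneg_right (statVar_orthoFun_le_supNorm h hn hf hS) s.coe_nonneg
    have h3 := mul_le_mul_of_nonneg_left h1 hpos.le
    have h4 : 0 ≤ n * (s * (supNorm μ f).toReal ^ 2) := by positivity
    nlinarith

/-- The concentration inequality for averages when the variance is small. -/
theorem ensemble_average_deviation_le_of_statVar_le (hn1 : 1 ≤ n) (h : HasFiniteMoments μ)
    (hn : (n : ℕ∞) ≤ μ.support.encard) {f : ℝ → ℝ} (hf : Measurable f) {ε : ℝ≥0} (hε : 0 < ε)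
    (hV : supNorm μ f ≠ ∞ → statVar μ (orthoFun μ n) f ≤ n * (ε : ℝ) ^ 2) :
    ensemble μ n {x | (ε : ℝ) ≤ |1 / (n : ℝ) * linStat f x - 1 / (n : ℝ) * meanLinStat μ n f|} ≤
      2 * expNeg ((n : ℝ≥0∞) * ε / (6 * supNorm μ f)) := by
  have hpos : (0 : ℝ) < n := by exact_mod_cast hn1
  have hε' : (0 : ℝ) < ε := hε
  have hcoe : (n : ℝ≥0∞) * ε = ((n * ε : ℝ≥0) : ℝ≥0∞) := by simp
  rw [setOf_le_abs_div_sub_div hn1, hcoe, ← mul_one_div]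
  refine le_two_mul_expNeg_mul (mul_pos (by exact_mod_cast hn1) hε) fun s hs => ?_
  rw [ENNReal.le_div_iff_mul_le (Or.inr one_ne_zero) (Or.inr ENNReal.one_ne_top)] at hs
  have := ensemble_deviation_le_of_supNorm h hn hf (ε := n * ε) (s := s) (fun hS => ?_) hs
  · simpa using this
  · have h1 := ENNReal.toReal_mono ENNReal.one_ne_top hs
    simp only [ENNReal.toReal_mul, ENNReal.coe_toReal, ENNReal.toReal_ofNat,
      ENNReal.toReal_one] at h1
    have h2 := statVar_orthoFun_le_supNorm h hn hf hS
    have h3 := hV hS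
    set S := (supNorm μ f).toReal
    set V := statVar μ (orthoFun μ n) f
    have hS0 : 0 ≤ S := ENNReal.toReal_nonneg
    have hs0 : (0 : ℝ) ≤ s := s.2
    -- With `6 s S ≤ 1`, the requirement `4 V s ≤ n ε` follows from `V ≤ n S²` when `S ≤ ε`, and
    -- from `V ≤ n ε²` when `ε < S`. The variance term therefore leaves the final minimum.
    rcases le_or_gt S ε with hc | hc
    · calc 4 * V * s ≤ 4 * (n * S ^ 2) * s := by gcongr
        _ = n * S * (4 * (s * S)) := by ring
        _ ≤ n * S * 1 := by
          gcongr
          nlinarith [mul_nonneg hs0 hS0]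
        _ ≤ n * ε := by rw [mul_one]; gcongr
    · have h5 : 4 * (s * ε : ℝ) ≤ 1 := by nlinarith
      calc 4 * V * s ≤ 4 * (n * (ε : ℝ) ^ 2) * s := by gcongr
        _ = n * ε * (4 * (s * ε)) := by ring
        _ ≤ n * ε * 1 := by gcongr
        _ = n * ε := mul_one _

lemma exists_sq_sub_le_of_uniformContinuousOn {f : ℝ → ℝ} {K : Set ℝ}
    (hf : UniformContinuousOn f K) {M : ℝ} (hM : ∀ x ∈ K, |f x| ≤ M) {η : ℝ} (hη : 0 < η) :
    ∃ C : ℝ, ∀ x ∈ K, ∀ y ∈ K, (f x - f y) ^ 2 ≤ η + C * (x - y) ^ 2 := by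
  obtain ⟨δ, hδ, h⟩ := Metric.uniformContinuousOn_iff.1 hf (Real.sqrt η) (Real.sqrt_pos.2 hη)
  -- Points closer than `δ` are handled by `η`; for the others `(x - y)² / δ² ≥ 1` absorbs the crude
  -- bound `(2 M)²`.
  refine ⟨(2 * M) ^ 2 / δ ^ 2, fun x hx y hy => ?_⟩
  rcases lt_or_ge |x - y| δ with hc | hc
  · have h1 := h x hx y hy hc
    rw [Real.dist_eq, Real.lt_sqrt (abs_nonneg _), sq_abs] at h1
    have : 0 ≤ (2 * M) ^ 2 / δ ^ 2 * (x - y) ^ 2 := by positivity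
    linarith
  · have h1 : |f x - f y| ≤ 2 * M := (abs_sub _ _).trans (by linarith [hM x hx, hM y hy])
    have h2 : (f x - f y) ^ 2 ≤ (2 * M) ^ 2 := by
      rw [← sq_abs]
      exact pow_le_pow_left₀ (abs_nonneg _) h1 2
    have h3 : δ ^ 2 ≤ (x - y) ^ 2 := by
      rw [← sq_abs (x - y)]
      exact pow_le_pow_left₀ hδ.le hc 2
    have h4 : (2 * M) ^ 2 ≤ (2 * M) ^ 2 / δ ^ 2 * (x - y) ^ 2 := by
      rw [div_mul_eq_mul_div, le_div_iff₀ (by positivity)]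
      gcongr
    linarith

/-- The law of `n⁻¹ X_f` concentrates at an exponential rate when the Jacobi coefficients are
`o(√n)`. -/
theorem eventually_ensemble_average_deviation_le {μ : ℕ → Measure ℝ}
    (hμ : ∀ n, 1 ≤ n → HasFiniteMoments (μ n) ∧ (n : ℕ∞) < (μ n).support.encard)
    (ha : Tendsto (fun n : ℕ => 1 / (n : ℝ) *
      (leadCoeff (μ n) (n - 1) / leadCoeff (μ n) n) ^ 2) atTop (𝓝 0))
    {f : ℝ → ℝ} (hf : Measurable f) {K : Set ℝ} (hK : ∀ n, 1 ≤ n → (μ n).support ⊆ K)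
    (hfK : UniformContinuousOn f K) {M : ℝ} (hM : ∀ x ∈ K, |f x| ≤ M)
    {ε : ℝ≥0} (hε : 0 < ε) :
    ∀ᶠ n : ℕ in atTop, ensemble (μ n) n
        {x | (ε : ℝ) ≤ |1 / (n : ℝ) * linStat f x - 1 / (n : ℝ) * meanLinStat (μ n) n f|} ≤
      2 * expNeg ((n : ℝ≥0∞) * ε / (6 * supNorm (μ n) f)) := by
  have hε' : (0 : ℝ) < ε := hε
  -- With `η = ε²` the first term of the variance bound is `n ε² / 2`; the Jacobi term is eventually
  -- below the other half.
  obtain ⟨C, hC⟩ := exists_sq_sub_le_of_uniformContinuousOn hfK hM (η := (ε : ℝ) ^ 2)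
    (by positivity)
  have ha' := ha.const_mul C
  rw [mul_zero] at ha'
  filter_upwards [eventually_ge_atTop 1,
    ha'.eventually_lt_const (show (0 : ℝ) < (ε : ℝ) ^ 2 / 2 by positivity)] with n hn1 hn2
  obtain ⟨h, hn⟩ := hμ n hn1
  have hpos : (0 : ℝ) < n := by exact_mod_cast hn1
  refine ensemble_average_deviation_le_of_statVar_le hn1 h hn.le hf hε fun hS => ?_
  refine (statVar_orthoFun_le h hn1 hn hf (ae_abs_le_supNorm hS)
    fun x hx y hy => hC x (hK n hn1 hx) y (hK n hn1 hy)).trans ?_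
  set a := (leadCoeff (μ n) (n - 1) / leadCoeff (μ n) n) ^ 2
  have h1 : C * a = n * (C * (1 / n * a)) := by field_simp
  have h2 := mul_le_mul_of_nonneg_left hn2.le hpos.le
  rw [h1]
  linarith

/-- Concentration of Lipschitz linear statistics when the Jacobi coefficients are bounded. -/
theorem exists_eventually_ensemble_lipschitz_deviation_le {μ : ℕ → Measure ℝ}
    (hμ : ∀ n, 1 ≤ n → HasFiniteMoments (μ n) ∧ (n : ℕ∞) < (μ n).support.encard)
    (ha : (fun n : ℕ => (leadCoeff (μ n) (n - 1) / leadCoeff (μ n) n) ^ 2)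
        =O[atTop] (fun _ => (1 : ℝ))) :
    ∃ A : ℝ≥0, 0 < A ∧ ∀ (f : ℝ → ℝ) (L : ℝ≥0), LipschitzWith L f →
      ∀ ε : ℝ≥0, 0 < ε → ∀ᶠ n : ℕ in atTop,
        ensemble (μ n) n {x | (ε : ℝ) ≤ |linStat f x - meanLinStat (μ n) n f|} ≤
          2 * expNeg ((ε : ℝ≥0∞) *
            min ((ε : ℝ≥0∞) / (4 * A * (L : ℝ≥0∞) ^ 2)) (1 / (6 * supNorm (μ n) f))) := by
  -- The constant `A` is the eventual bound on the squared Jacobi coefficients, so it does not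
  -- depend on `f` or `ε`.
  obtain ⟨c, hc, hbound⟩ := ha.exists_pos
  refine ⟨c.toNNReal, Real.toNNReal_pos.2 hc, fun f L hL ε hε => ?_⟩
  filter_upwards [eventually_ge_atTop 1, hbound.bound] with n hn1 hn2
  obtain ⟨h, hn⟩ := hμ n hn1
  have hf : Measurable f := hL.continuous.measurable
  refine le_two_mul_expNeg_mul hε fun s hs => ?_
  obtain ⟨hs1, hs2⟩ := le_min_iff.1 hs
  rw [ENNReal.le_div_iff_mul_le (Or.inr (by simpa using hε.ne')) (Or.inr ENNReal.coe_ne_top)] at hs1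
  rw [ENNReal.le_div_iff_mul_le (Or.inr one_ne_zero) (Or.inr ENNReal.one_ne_top)] at hs2
  refine ensemble_deviation_le_of_supNorm h hn.le hf (fun hS => ?_) hs2
  have h1 := ENNReal.toReal_mono ENNReal.coe_ne_top hs1
  simp only [ENNReal.toReal_mul, ENNReal.coe_toReal, ENNReal.toReal_ofNat,
    ENNReal.toReal_pow, Real.coe_toNNReal _ hc.le] at h1
  have h2 := statVar_orthoFun_le h hn1 hn hf (ae_abs_le_supNorm hS) (η := 0) (C := (L : ℝ) ^ 2)
    fun x _ y _ => by
      have := hL.dist_le_mul x y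
      rw [Real.dist_eq, Real.dist_eq] at this
      rw [zero_add, ← sq_abs, ← sq_abs (x - y), ← mul_pow]
      exact pow_le_pow_left₀ (abs_nonneg _) this 2
  rw [Real.norm_of_nonneg (sq_nonneg _), norm_one, mul_one] at hn2
  have h3 := mul_le_mul_of_nonneg_left hn2 (sq_nonneg (L : ℝ))
  have h4 := mul_le_mul_of_nonneg_right ((h2.trans (by linarith :
    _ ≤ (L : ℝ) ^ 2 * c))) s.coe_nonneg
  linarith

/-! ### The law of large numbers -/

lemma integral_meanDensity (h : HasFiniteMoments μ) (hn : (n : ℕ∞) ≤ μ.support.encard)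
    {f : ℝ → ℝ} (hf : Measurable f) {S : ℝ} (hS : ∀ᵐ x ∂μ, |f x| ≤ S) :
    ∫ x, f x ∂(meanDensity μ n) = 1 / (n : ℝ) * meanLinStat μ n f := by
  have hm : Measurable fun x => cdKernel μ n x x / n := by
    unfold cdKernel
    have : ∀ j, Measurable fun x => (orthoPoly μ j).eval x := fun j =>
      (orthoPoly μ j).continuous.measurable
    fun_prop
  have hpos : ∀ x, 0 ≤ cdKernel μ n x x / n := fun x =>
    div_nonneg (Finset.sum_nonneg fun _ _ => mul_self_nonneg _) n.cast_nonneg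
  rw [meanDensity, integral_withDensity_eq_integral_toReal_smul hm.ennreal_ofReal
    (.of_forall fun x => ENNReal.ofReal_lt_top), meanLinStat_eq h hn hf hS]
  have e : ∀ x, (ENNReal.ofReal (cdKernel μ n x x / n)).toReal • f x =
      1 / (n : ℝ) * ∑ i : Fin n, f x * (orthoFun μ n i x * orthoFun μ n i x) := fun x => by
    rw [ENNReal.toReal_ofReal (hpos x), smul_eq_mul, cdKernel, Finset.sum_range, ← Finset.mul_sum]
    simp only [orthoFun]
    ring
  simp only [e]
  rw [integral_const_mul, integral_finsetSum _ fun i _ =>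
    ((isOrthonormalFamily_orthoFun h hn).integrable i i).bdd_mul hf.aestronglyMeasurable hS]
  rfl

/-- The strong law of large numbers for linear statistics. -/
theorem ae_tendsto_average_linStat {μ : ℕ → Measure ℝ} {ν : Measure ℝ}
    (hμ : ∀ n, 1 ≤ n → HasFiniteMoments (μ n) ∧ (n : ℕ∞) ≤ (μ n).support.encard)
    (hν : TendstoWeakly (fun n => meanDensity (μ n) n) ν) (f : ℝ →ᵇ ℝ)
    {Ω : Type*} [MeasurableSpace Ω] {P : Measure Ω} [IsProbabilityMeasure P]
    {x : (n : ℕ) → Ω → Fin n → ℝ} (hx : ∀ n, 1 ≤ n → HasLaw (x n) (ensemble (μ n) n) P) :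
    ∀ᵐ ω ∂P, Tendsto (fun n : ℕ => 1 / (n : ℝ) * linStat f (x n ω)) atTop
      (𝓝 (∫ t, f t ∂ν)) := by
  have hf : Measurable f := f.continuous.measurable
  have hS : ∀ n, ∀ᵐ t ∂(μ n), |f t| ≤ ‖f‖ := fun n => .of_forall fun t => f.norm_coe_le_norm t
  have hmean : Tendsto (fun n : ℕ => 1 / (n : ℝ) * meanLinStat (μ n) n f) atTop
      (𝓝 (∫ t, f t ∂ν)) := by
    refine (hν f).congr' ?_
    filter_upwards [eventually_ge_atTop 1] with n hn1
    exact integral_meanDensity (hμ n hn1).1 (hμ n hn1).2 hf (hS n)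
  have hdev : ∀ k : ℕ, ∀ᵐ ω ∂P, ∀ᶠ n : ℕ in atTop, |1 / (n : ℝ) * linStat f (x n ω) -
      1 / (n : ℝ) * meanLinStat (μ n) n f| < 1 / ((k : ℝ) + 1) := by
    intro k
    set ε : ℝ := 1 / ((k : ℝ) + 1) with hε
    have hε0 : 0 < ε := by positivity
    -- A positive rate independent of `n`, so the deviation bounds are geometric in `n`. The added
    -- `1`s keep the denominators positive when `f = 0`.
    set s : ℝ := min (ε / (4 * ‖f‖ ^ 2 + 1)) (1 / (6 * ‖f‖ + 1)) with hs
    have hs0 : 0 < s := lt_min (by positivity) (by positivity)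
    have hs1 : s * (4 * ‖f‖ ^ 2 + 1) ≤ ε :=
      (le_div_iff₀ (by positivity)).1 (min_le_left _ _)
    have hs2 : s * (6 * ‖f‖ + 1) ≤ 1 := (le_div_iff₀ (by positivity)).1 (min_le_right _ _)
    have hbound : ∀ n : ℕ, P {ω | ε ≤ |1 / (n : ℝ) * linStat f (x n ω) -
        1 / (n : ℝ) * meanLinStat (μ n) n f|} ≤
        ENNReal.ofReal (2 * Real.exp (-(ε * s)) ^ n) := by
      intro n
      -- No law is prescribed for `x 0`, but the bound is `2` there.
      rcases Nat.eq_zero_or_pos n with rfl | hn1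
      · refine prob_le_one.trans ?_
        simp
      · obtain ⟨h, hn⟩ := hμ n hn1
        have hpos : (0 : ℝ) < n := by exact_mod_cast hn1
        have hms : MeasurableSet {y : Fin n → ℝ | ε ≤ |1 / (n : ℝ) * linStat f y -
            1 / (n : ℝ) * meanLinStat (μ n) n f|} :=
          measurableSet_le measurable_const
            (((measurable_linStat hf).const_mul _).sub_const _).abs
        have hmap : P {ω | ε ≤ |1 / (n : ℝ) * linStat f (x n ω) -
            1 / (n : ℝ) * meanLinStat (μ n) n f|} = ensemble (μ n) n {y : Fin n → ℝ |
            ε ≤ |1 / (n : ℝ) * linStat f y - 1 / (n : ℝ) * meanLinStat (μ n) n f|} := by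
          rw [← (hx n hn1).map_eq, Measure.map_apply_of_aemeasurable (hx n hn1).aemeasurable hms]
          rfl
        have hV : statVar (μ n) (orthoFun (μ n) n) f ≤ n * ‖f‖ ^ 2 := by
          simpa using (isOrthonormalFamily_orthoFun h hn).statVar_le hf.aestronglyMeasurable (hS n)
        rw [hmap, setOf_le_abs_div_sub_div hn1]
        refine (ensemble_deviation_le h hn hf (hS n) hs0.le ?_ (by linarith)).trans ?_
        · have h1 := mul_le_mul_of_nonneg_right hV hs0.le
          have h2 := mul_le_mul_of_nonneg_left hs1 hpos.le
          have h3 := mul_pos hpos hs0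
          linarith
        · rw [ENNReal.ofReal_mul zero_le_two, ENNReal.ofReal_ofNat, ← Real.exp_nat_mul]
          refine le_of_eq ?_
          congr 3
          ring
    have hsum : Summable fun n : ℕ => 2 * Real.exp (-(ε * s)) ^ n :=
      (summable_geometric_of_lt_one (Real.exp_pos _).le
        (Real.exp_lt_one_iff.2 (by linarith [mul_pos hε0 hs0]))).mul_left 2
    -- This half of Borel–Cantelli needs no independence, hence the arbitrary joint law.
    have := ae_eventually_notMem (ne_top_of_le_ne_top hsum.tsum_ofReal_ne_top
      (ENNReal.tsum_le_tsum hbound))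
    filter_upwards [this] with ω hω
    filter_upwards [hω] with n hn
    exact not_le.1 hn
  filter_upwards [ae_all_iff.2 hdev] with ω hω
  have hzero : Tendsto (fun n : ℕ => 1 / (n : ℝ) * linStat f (x n ω) -
      1 / (n : ℝ) * meanLinStat (μ n) n f) atTop (𝓝 0) := by
    rw [Metric.tendsto_atTop']
    intro δ hδ
    obtain ⟨k, hk⟩ := exists_nat_one_div_lt hδ
    obtain ⟨N, hN⟩ := eventually_atTop.1 (hω k)
    refine ⟨N, fun n hn => ?_⟩
    rw [Real.dist_eq, sub_zero]
    exact (hN n hn.le).trans hk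
  simpa using hzero.add hmean

lemma exists_leadCoeff_div_sq_le (h : HasFiniteMoments μ) (hinf : μ.support.Infinite)
    (hc : IsCompact μ.support) :
    ∃ B : ℝ, ∀ n : ℕ, 1 ≤ n → (leadCoeff μ (n - 1) / leadCoeff μ n) ^ 2 ≤ B := by
  obtain ⟨R, hR⟩ := hc.isBounded.exists_norm_le
  refine ⟨R ^ 2, fun n hn => ?_⟩
  obtain ⟨k, rfl⟩ : ∃ k, n = k + 1 := ⟨n - 1, by omega⟩
  refine leadCoeff_div_sq_le h ?_ hR
  rw [hinf.encard_eq]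
  exact ENat.natCast_lt_top _

end Bounds

end OPE

theorem mainTheorem4 :
    -- I, the concentration inequality
    (∃ A : ℝ≥0, 0 < A ∧
      ∀ (μ : Measure ℝ) (n : ℕ), 1 ≤ n → OPE.HasFiniteMoments μ →
        (n : ℕ∞) ≤ μ.support.encard →
      ∀ f : ℝ → ℝ, Measurable f → (∃ M : ℝ, ∀ x, |f x| ≤ M) →
      ∀ ε : ℝ≥0, 0 < ε →
        OPE.ensemble μ n
            {x | (ε : ℝ) ≤ |1 / (n : ℝ) * OPE.linStat f x - 1 / (n : ℝ) * OPE.meanLinStat μ n f|} ≤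
          2 * OPE.expNeg ((n : ℝ≥0∞) * ε *
            min ((ε : ℝ≥0∞) / (8 * A * OPE.supNorm μ f ^ 2)) (1 / (6 * OPE.supNorm μ f)))) ∧
    -- I, the law of large numbers
    (∀ (μ : ℕ → Measure ℝ) (ν : Measure ℝ), IsFiniteMeasure ν →
      (∀ n, 1 ≤ n → OPE.HasFiniteMoments (μ n) ∧ (n : ℕ∞) ≤ (μ n).support.encard) →
      OPE.TendstoWeakly (fun n => OPE.meanDensity (μ n) n) ν →
      ∀ f : ℝ →ᵇ ℝ,
      ∀ (Ω : Type*) [MeasurableSpace Ω] (P : Measure Ω) [IsProbabilityMeasure P]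
        (x : (n : ℕ) → Ω → Fin n → ℝ),
        (∀ n, 1 ≤ n → HasLaw (x n) (OPE.ensemble (μ n) n) P) →
        ∀ᵐ ω ∂P, Tendsto (fun n : ℕ => 1 / (n : ℝ) * OPE.linStat f (x n ω)) atTop
          (𝓝 (∫ t, f t ∂ν))) ∧
    -- II, a fixed measure with compact support
    (∀ μ : Measure ℝ, OPE.HasFiniteMoments μ → μ.support.Infinite → IsCompact μ.support →
      ∀ f : ℝ → ℝ, Continuous f →
      ∀ ε : ℝ≥0, 0 < ε → ∀ᶠ n : ℕ in atTop,
        OPE.ensemble μ n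
            {x | (ε : ℝ) ≤ |1 / (n : ℝ) * OPE.linStat f x - 1 / (n : ℝ) * OPE.meanLinStat μ n f|} ≤
          2 * OPE.expNeg ((n : ℝ≥0∞) * ε / (6 * OPE.supNorm μ f))) ∧
    -- II, a sequence of measures
    (∀ μ : ℕ → Measure ℝ,
      (∀ n, 1 ≤ n → OPE.HasFiniteMoments (μ n) ∧ (n : ℕ∞) < (μ n).support.encard) →
      Tendsto (fun n : ℕ => 1 / (n : ℝ) *
        (OPE.leadCoeff (μ n) (n - 1) / OPE.leadCoeff (μ n) n) ^ 2) atTop (𝓝 0) →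
      ∀ f : ℝ → ℝ, UniformContinuous f → (∃ M : ℝ, ∀ x, |f x| ≤ M) →
      ∀ ε : ℝ≥0, 0 < ε → ∀ᶠ n : ℕ in atTop,
        OPE.ensemble (μ n) n
            {x | (ε : ℝ) ≤
              |1 / (n : ℝ) * OPE.linStat f x - 1 / (n : ℝ) * OPE.meanLinStat (μ n) n f|} ≤
          2 * OPE.expNeg ((n : ℝ≥0∞) * ε / (6 * OPE.supNorm (μ n) f))) ∧
    -- III, a fixed measure with compact support
    (∀ μ : Measure ℝ, OPE.HasFiniteMoments μ → μ.support.Infinite → IsCompact μ.support →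
      ∃ A : ℝ≥0, 0 < A ∧
        ∀ (f : ℝ → ℝ) (L : ℝ≥0), LipschitzWith L f →
        ∀ ε : ℝ≥0, 0 < ε → ∀ᶠ n : ℕ in atTop,
          OPE.ensemble μ n {x | (ε : ℝ) ≤ |OPE.linStat f x - OPE.meanLinStat μ n f|} ≤
            2 * OPE.expNeg ((ε : ℝ≥0∞) *
              min ((ε : ℝ≥0∞) / (4 * A * (L : ℝ≥0∞) ^ 2)) (1 / (6 * OPE.supNorm μ f)))) ∧
    -- III, a sequence of measures
    (∀ μ : ℕ → Measure ℝ,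
      (∀ n, 1 ≤ n → OPE.HasFiniteMoments (μ n) ∧ (n : ℕ∞) < (μ n).support.encard) →
      (fun n : ℕ => (OPE.leadCoeff (μ n) (n - 1) / OPE.leadCoeff (μ n) n) ^ 2)
        =O[atTop] (fun _ => (1 : ℝ)) →
      ∃ A : ℝ≥0, 0 < A ∧
        ∀ (f : ℝ → ℝ) (L : ℝ≥0), LipschitzWith L f →
        ∀ ε : ℝ≥0, 0 < ε → ∀ᶠ n : ℕ in atTop,
          OPE.ensemble (μ n) n {x | (ε : ℝ) ≤ |OPE.linStat f x - OPE.meanLinStat (μ n) n f|} ≤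
            2 * OPE.expNeg ((ε : ℝ≥0∞) *
              min ((ε : ℝ≥0∞) / (4 * A * (L : ℝ≥0∞) ^ 2)) (1 / (6 * OPE.supNorm (μ n) f)))) := by
  have hconst : ∀ μ : Measure ℝ, OPE.HasFiniteMoments μ → μ.support.Infinite →
      ∀ n : ℕ, 1 ≤ n → OPE.HasFiniteMoments μ ∧ (n : ℕ∞) < μ.support.encard :=
    fun μ h hinf n _ => ⟨h, by rw [hinf.encard_eq]; exact ENat.natCast_lt_top _⟩
  -- `A = 1` suffices since `V ≤ n ‖f‖_∞²`; a factor `2` is even to spare.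
  refine ⟨⟨1, one_pos, fun μ n hn1 h hn f hf _ ε hε =>
    OPE.ensemble_average_deviation_le hn1 h hn hf hε⟩,
    fun μ ν _ hμ hν f Ω _ P _ x hx => OPE.ae_tendsto_average_linStat hμ hν f hx, ?_, ?_, ?_,
    fun μ hμ ha => OPE.exists_eventually_ensemble_lipschitz_deviation_le hμ ha⟩
  · intro μ h hinf hc f hf ε hε
    obtain ⟨B, hB⟩ := OPE.exists_leadCoeff_div_sq_le h hinf hc
    obtain ⟨M, hM⟩ := hc.exists_bound_of_continuousOn hf.continuousOn
    refine OPE.eventually_ensemble_average_deviation_le (μ := fun _ => μ) (hconst μ h hinf) ?_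
      hf.measurable (fun _ _ => subset_rfl)
      (hc.uniformContinuousOn_of_continuous hf.continuousOn) hM hε
    have hlim : Tendsto (fun n : ℕ => 1 / (n : ℝ) * B) atTop (𝓝 0) := by
      simpa using tendsto_one_div_atTop_nhds_zero_nat.mul_const B
    refine squeeze_zero' (.of_forall fun n => by positivity) ?_ hlim
    filter_upwards [eventually_ge_atTop 1] with n hn
    exact mul_le_mul_of_nonneg_left (hB n hn) (by positivity)
  · intro μ hμ ha f hf hM ε hε
    obtain ⟨M, hM⟩ := hM
    exact OPE.eventually_ensemble_average_deviation_le hμ ha hf.continuous.measurable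
      (fun _ _ => Set.subset_univ _) hf.uniformContinuousOn (fun x _ => hM x) hε
  · intro μ h hinf hc
    obtain ⟨B, hB⟩ := OPE.exists_leadCoeff_div_sq_le h hinf hc
    refine OPE.exists_eventually_ensemble_lipschitz_deviation_le (μ := fun _ => μ)
      (hconst μ h hinf) (Asymptotics.IsBigO.of_bound B ?_)
    filter_upwards [eventually_ge_atTop 1] with n hn
    rw [Real.norm_of_nonneg (sq_nonneg _), norm_one, mul_one]
    exact hB n hn
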